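/- A \emph{space of quasi-polynomials} is a complex vector space $V$ of functions on $\mathbb C$ spanned by functions $p_{ij}(x)e^{\lambda_i x}$, $i=1,\dots,n$, $j=1,\dots,N_i$, where $N_i\ge 1$, $\lambda_1,\dots,\lambda_n\in\mathbb C$ are distinct and, for each $i$, the $p_{ij}\in\mathbb C[x]$ satisfy $0<\deg p_{i1}<\dots<\deg p_{iN_i}$. Put $N=\dim V=N_1+\dots+N_n$. For $z\in\mathbb C$, the exponents of $V$ at $z$ are the orders at $z$ of the nonzero elements of $V$; $z$ is a singular point of $V$ if the set of exponents is not $\{0,\dots,N-1\}$. Let $z_1,\dots,z_m$ be the (finitely many) singular points of $V$. Let $\bar D_V$ be the unique monic linear differential operator of order $N$ with meromorphic coefficients annihilating $V$, and let $M_a$ be the smallest natural number such that all coefficients of $(x-z_a)^{M_a}\bar D_V$ have no pole at $z_a$. Let $\mathrm{Wr}_V$ be the Wronskian of a basis of $V$ (defined up to a nonzero constant factor), let $V^\star$ be the span of all functions $\mathrm{Wr}(f_1,\dots,f_{N-1})/\mathrm{Wr}_V$ with $f_1,\dots,f_{N-1}\in V$, and let $V^\dagger$ be the space of all functions $f\prod_{a=1}^m(x-z_a)^{-M_a}$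 with $f\in V^\star$. The space \emph{bispectral dual to} $V$ is the complex vector space $U$ spanned by the functions $$\hat f_a(u)=\int_{\gamma_a}e^{ux}f(x)\,dx,\qquad a=1,\dots,m,\quad f\in V^\dagger,$$ where $\gamma_a$ is a small circle around $z_a$ oriented counterclockwise. Let $V$ be a space of quasi-polynomials and let $U$ be the space bispectral dual to $V$. Then $U$ is a space of quasi-polynomials, and $V$ is the space bispectral dual to $U$. -/

import Mathlib

open scoped Topology Polynomial

noncomputable section

namespace Bispectral

/-- The Wronskian `Wr(f_1, …, f_k)`: the determinant of the matrix whose `j`-th row is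
`f_j, f_j', …, f_j^{(k-1)}`. -/
def wronskian {k : ℕ} (f : Fin k → ℂ → ℂ) (x : ℂ) : ℂ :=
  (Matrix.of fun j i : Fin k => iteratedDeriv (i : ℕ) (f j) x).det

/-- The determinant of the `k × k` matrix whose `j`-th row consists of the derivatives of `f_j` of
orders `0, …, k` with the order `p` omitted. -/
def wronskianOmit {k : ℕ} (f : Fin k → ℂ → ℂ) (p : Fin (k + 1)) (x : ℂ) : ℂ :=
  (Matrix.of fun j i : Fin k => iteratedDeriv (p.succAbove i : ℕ) (f j) x).det

/-- The coefficient of `∂_x^p` in the monic differential operator of order `k` that annihilates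
`f_1, …, f_k`. For `p = k` this is `Wr / Wr`, i.e. `1` off the zeros of the Wronskian. -/
def monicCoeff {k : ℕ} (f : Fin k → ℂ → ℂ) (p : Fin (k + 1)) (x : ℂ) : ℂ :=
  (-1) ^ (k - (p : ℕ)) * (wronskianOmit f p x / wronskian f x)

/-- The set of exponents of `V` at `z`: the orders at `z` of the nonzero elements of `V`
(the zero function has order `⊤`). -/
def exponents (V : Submodule ℂ (ℂ → ℂ)) (z : ℂ) : Set ℤ :=
  {e | ∃ f ∈ V, meromorphicOrderAt f z = (e : WithTop ℤ)}

/-- The points at which the set of exponents differs from `{0, …, N - 1}`, `N = dim V`. -/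
def singularPoints (V : Submodule ℂ (ℂ → ℂ)) : Set ℂ :=
  {z | exponents V z ≠ Set.Ico (0 : ℤ) (Module.finrank ℂ V : ℤ)}

/-- The smallest `k` such that all coefficients of `(x - z)^k D̄_V` have no pole at `z`, where
`D̄_V` is the monic fundamental operator of `V`. (`D̄_V` does not depend on the basis of `V` through
which its coefficients are written.) -/
def poleOrder (V : Submodule ℂ (ℂ → ℂ)) (z : ℂ) : ℕ :=
  sInf {k : ℕ | ∃ b : Module.Basis (Fin (Module.finrank ℂ V)) ℂ V,
    ∀ p, 0 ≤ meromorphicOrderAt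
      (fun x => (x - z) ^ k * monicCoeff (fun j => (b j : ℂ → ℂ)) p x) z}

/-- The leading coefficient `∏_a (x - z_a)^{M_a}` of the regularized fundamental operator of `V`;
the product is over the singular points of `V`. -/
def leadingCoeff (V : Submodule ℂ (ℂ → ℂ)) (x : ℂ) : ℂ :=
  ∏ᶠ z ∈ singularPoints V, (x - z) ^ poleOrder V z

/-- The conjugate space `V^⋆`, spanned by all `Wr(f_1, …, f_{N-1}) / Wr_V` with `f_i ∈ V`; here
`Wr_V` is the Wronskian of a basis of `V`, which is defined up to a nonzero constant factor. -/
def conjugate (V : Submodule ℂ (ℂ → ℂ)) : Submodule ℂ (ℂ → ℂ) :=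
  Submodule.span ℂ {g | ∃ b : Module.Basis (Fin (Module.finrank ℂ V)) ℂ V,
    ∃ k : ℕ, k + 1 = Module.finrank ℂ V ∧ ∃ f : Fin k → ℂ → ℂ, (∀ j, f j ∈ V) ∧
      g = fun x => wronskian f x / wronskian (fun j => (b j : ℂ → ℂ)) x}

/-- The regularized conjugate space `V^†`, spanned by all `f ∏_a (x - z_a)^{-M_a}`, `f ∈ V^⋆`. -/
def regularizedConjugate (V : Submodule ℂ (ℂ → ℂ)) : Submodule ℂ (ℂ → ℂ) :=
  Submodule.span ℂ {g | ∃ f ∈ conjugate V, g = fun x => f x * (leadingCoeff V x)⁻¹}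

/-- `g(u) = ∫_γ e^{ux} f(x) dx` for every sufficiently small counterclockwise circle `γ` around
`z`. -/
def IsIntegralTransform (f : ℂ → ℂ) (z : ℂ) (g : ℂ → ℂ) : Prop :=
  ∀ᶠ r : ℝ in 𝓝[>] 0, ∀ u : ℂ, g u = ∮ x in C(z, r), Complex.exp (u * x) * f x

/-- The space spanned by the integral transforms of the elements of `V^†` around the singular
points of `V`. -/
def transformSpace (V : Submodule ℂ (ℂ → ℂ)) : Submodule ℂ (ℂ → ℂ) :=
  Submodule.span ℂ {g | ∃ z ∈ singularPoints V, ∃ f ∈ regularizedConjugate V,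
    IsIntegralTransform f z g}

/-- `V` is a space of quasi-polynomials: it is spanned by functions `p_{ij}(x) e^{λ_i x}`,
`i = 1, …, n`, `j = 1, …, N_i`, where the `λ_i` are distinct complex numbers and the `p_{ij}` are
polynomials with `0 < deg p_{i1} < … < deg p_{iN_i}` for each `i`. -/
def IsQuasiPolynomialSpace (V : Submodule ℂ (ℂ → ℂ)) : Prop :=
  ∃ (n : ℕ) (N : Fin n → ℕ) (l : Fin n → ℂ) (p : (i : Fin n) → Fin (N i) → ℂ[X]),
    (∀ i, 0 < N i) ∧ Function.Injective l ∧
    (∀ i j, 0 < (p i j).natDegree) ∧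
    (∀ i, StrictMono fun j => (p i j).natDegree) ∧
    V = Submodule.span ℂ (Set.range fun (a : (i : Fin n) × Fin (N i)) =>
      fun x : ℂ => (p a.1 a.2).eval x * Complex.exp (l a.1 * x))

/-- `U` is bispectral dual to `V`. The notion is defined for spaces `V` of quasi-polynomials
only. -/
def IsBispectralDual (U V : Submodule ℂ (ℂ → ℂ)) : Prop :=
  IsQuasiPolynomialSpace V ∧ U = transformSpace V

end Bispectral

end

open scoped Topology Polynomial

noncomputable section

namespace Bispectral

open Polynomial

/-! The space V is the full space of entire solutions of an operator D = ∑ A_p(x) ∂^p of order N =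
dim V, with polynomial coefficients that have no common zero and a monic leading coefficient P = A_N
whose degree M bounds the other degrees (`exists_isRegularOp`). The duality exchanges x and ∂ in D:
it turns the symbol ∑ a_{jk} x^j u^k into an operator D' of order M whose leading coefficient has
degree N.

The transform U of V is killed by D'. Applying D' to ∮ e^{ux} f(x) dx under the integral sign turns
e^{ux} into D e^{ux}. For f = w_j / P, with w_j in the conjugate space, variation of parameters
gives a single-valued primitive of the integrand (`IsRegularOp.exists_hasDerivAt`), so the integral
vanishes.

The dimension of U is M. At each z there is an s such that 0, …, s - 1 are exponents, s is not, and
z is a root of P of multiplicity N - s (`IsRegularOp.exists_exponent_gap`). In an adapted basis w_j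
/ P has order s - 1 - e_j at z, so its transform is zero if e_j < s and is a polynomial of degree
e_j - s > 0 times e^{zu} if e_j > s. The second case occurs N - s times, and the multiplicities add
up to deg P = M. The gap at s is why all degrees are positive. Together this is
`IsRegularOp.transformSpace_spec`.

D' has the same normal form, now for U: a common zero μ of its coefficients would put e^{μx} in V,
which positivity of the degrees forbids (`IsRegularOp.swap`). Hence the transform of U has dimension
N and is killed by D'' = D, so it is V (`eq_of_act_eq_zero`). -/

/-! ### Quasi-polynomials: derivatives and linear independence -/

/-- The quasi-polynomial `p(x) e^{l x}`. -/
def qexp (p : ℂ[X]) (l : ℂ) (x : ℂ) : ℂ := p.eval x * Complex.exp (l * x)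

/-- The action of the derivative on the polynomial factor of `p(x) e^{l x}`. -/
def expDeriv (l : ℂ) (p : ℂ[X]) : ℂ[X] := derivative p + C l * p

lemma hasDerivAt_qexp (p : ℂ[X]) (l x : ℂ) :
    HasDerivAt (qexp p l) (qexp (expDeriv l p) l x) x := by
  have h1 := p.hasDerivAt x
  have h2 : HasDerivAt (fun x : ℂ => Complex.exp (l * x)) (Complex.exp (l * x) * l) x := by
    simpa using ((hasDerivAt_id x).const_mul l).cexp
  refine (h1.mul h2).congr_deriv ?_
  simp only [qexp, expDeriv, eval_add, eval_mul, eval_C]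
  ring

lemma differentiable_qexp (p : ℂ[X]) (l : ℂ) : Differentiable ℂ (qexp p l) :=
  fun x => (hasDerivAt_qexp p l x).differentiableAt

lemma deriv_qexp (p : ℂ[X]) (l : ℂ) : deriv (qexp p l) = qexp (expDeriv l p) l :=
  funext fun x => (hasDerivAt_qexp p l x).deriv

lemma iteratedDeriv_qexp (p : ℂ[X]) (l : ℂ) (k : ℕ) :
    iteratedDeriv k (qexp p l) = qexp ((expDeriv l)^[k] p) l := by
  induction k generalizing p with
  | zero => simp
  | succ k ih => rw [iteratedDeriv_succ', deriv_qexp, ih, Function.iterate_succ_apply]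

lemma expDeriv_zero_iterate (l : ℂ) (k : ℕ) : (expDeriv l)^[k] 0 = 0 :=
  Function.iterate_fixed (by simp [expDeriv]) k

/-- Differentiation lowers the degree while multiplication by l ≠ 0 keeps it, so the two terms
cannot cancel. -/
lemma expDeriv_injective {l : ℂ} (hl : l ≠ 0) : Function.Injective (expDeriv l) := by
  intro p q h
  rw [← sub_eq_zero]
  set r := p - q with hr
  have h0 : derivative r + C l * r = 0 := by
    simp only [expDeriv] at h
    rw [hr, derivative_sub]
    linear_combination h
  by_contra hne
  have h1 : degree (derivative r) < degree r := degree_derivative_lt hne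
  have h2 : degree (C l * r) = degree r := degree_C_mul hl
  have h3 : derivative r = -(C l * r) := by linear_combination h0
  rw [h3, degree_neg, h2] at h1
  exact lt_irrefl _ h1

lemma qexp_eq_zero {p : ℂ[X]} {l : ℂ} (h : ∀ x, qexp p l x = 0) : p = 0 := by
  refine Polynomial.funext fun x => ?_
  have := h x
  simp only [qexp, mul_eq_zero, Complex.exp_ne_zero, or_false] at this
  simpa using this

lemma qexp_mul_exp (p : ℂ[X]) (l m x : ℂ) :
    qexp p l x * Complex.exp (m * x) = qexp p (l + m) x := by
  simp only [qexp, mul_assoc, ← Complex.exp_add]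
  ring_nf

/-- Polynomials are independent over exponentials of distinct frequencies. -/
lemma eq_zero_of_sum_qexp_eq_zero (S : Finset ℂ) (P : ℂ → ℂ[X])
    (h : ∀ x, ∑ l ∈ S, qexp (P l) l x = 0) : ∀ l ∈ S, P l = 0 := by
  induction S using Finset.induction_on generalizing P with
  | empty => simp
  | insert m S hm ih =>
    -- Dividing by e^{mx} makes the m-term a polynomial, which deg + 1 derivatives kill; on the
    -- other frequencies these derivatives act injectively.
    have h1 : ∀ x, qexp (P m) 0 x + ∑ l ∈ S, qexp (P l) (l - m) x = 0 := by
      intro x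
      have h2 := congrArg (· * Complex.exp (-m * x)) (h x)
      simp only [Finset.sum_insert hm, add_mul, Finset.sum_mul, qexp_mul_exp, zero_mul] at h2
      simpa [sub_eq_add_neg] using h2
    have hd : (expDeriv 0)^[(P m).natDegree + 1] (P m) = 0 := by
      have : expDeriv 0 = derivative := by
        funext p
        simp [expDeriv]
      rw [this]
      exact iterate_derivative_eq_zero (Nat.lt_succ_self _)
    have h3 : ∀ x,
        ∑ l ∈ S, qexp ((expDeriv (l - m))^[(P m).natDegree + 1] (P l)) (l - m) x = 0 := by
      intro x
      have h4 : iteratedDeriv ((P m).natDegree + 1)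
          (fun x => qexp (P m) 0 x + ∑ l ∈ S, qexp (P l) (l - m) x) x = 0 := by
        rw [funext h1]
        simp
      have hc : ∀ p l, ContDiffAt ℂ (((P m).natDegree + 1 : ℕ) : WithTop ℕ∞) (qexp p l) x :=
        fun p l => (differentiable_qexp p l).contDiff.contDiffAt
      rw [iteratedDeriv_fun_add (hc _ _) (ContDiffAt.sum fun _ _ => hc _ _),
        iteratedDeriv_fun_sum fun _ _ => hc _ _] at h4
      simpa [iteratedDeriv_qexp, hd, qexp] using h4
    have h5 : ∀ l ∈ S, P l = 0 := by
      intro l hl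
      have := ih (fun l => (expDeriv (l - m))^[(P m).natDegree + 1] (P l)) (fun x => by
        have h6 := congrArg (· * Complex.exp (m * x)) (h3 x)
        simpa only [Finset.sum_mul, qexp_mul_exp, sub_add_cancel, zero_mul] using h6) l hl
      refine (expDeriv_injective (sub_ne_zero.2 ?_)).iterate ((P m).natDegree + 1)
        (this.trans (expDeriv_zero_iterate _ _).symm)
      rintro rfl
      exact hm hl
    intro l hl
    rcases Finset.mem_insert.1 hl with rfl | hl
    · refine qexp_eq_zero (l := l) fun x => ?_
      have h7 := h x
      rwa [Finset.sum_insert hm, Finset.sum_eq_zero, add_zero] at h7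
      intro i hi
      simp [h5 i hi, qexp]
    · exact h5 l hl

lemma linearIndependent_of_natDegree_injective {ι : Type*} (q : ι → ℂ[X]) (hq : ∀ a, q a ≠ 0)
    (hinj : Function.Injective fun a => (q a).natDegree) : LinearIndependent ℂ q := by
  rw [linearIndependent_iff']
  intro s c h a ha
  by_contra hne
  have h1 := degree_sum_eq_of_disjoint (fun a => c a • q a) s (by
    rintro i ⟨-, hi⟩ j ⟨-, hj⟩ hij heq
    apply hij
    apply hinj
    have hi' : c i ≠ 0 := fun h => hi (by simp [h])
    have hj' : c j ≠ 0 := fun h => hj (by simp [h])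
    simp only [Function.comp_apply, smul_eq_C_mul, degree_C_mul hi', degree_C_mul hj'] at heq
    exact natDegree_eq_of_degree_eq heq)
  rw [h, degree_zero] at h1
  have h2 := Finset.le_sup (f := fun a => degree (c a • q a)) ha
  rw [← h1] at h2
  simp only [le_bot_iff, degree_eq_bot, smul_eq_zero, hne, hq a, or_self] at h2

lemma linearIndependent_qexp {ι : Type*} (q : ι → ℂ[X]) (m : ι → ℂ) (hq : ∀ a, q a ≠ 0)
    (hinj : Function.Injective fun a => (m a, (q a).natDegree)) :
    LinearIndependent ℂ fun a => qexp (q a) (m a) := by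
  classical
  rw [linearIndependent_iff']
  intro s c h a ha
  have h1 : ∀ x, ∑ l ∈ s.image m, qexp (∑ b ∈ s with m b = l, c b • q b) l x = 0 := by
    intro x
    have h2 := congrFun h x
    rw [Finset.sum_apply, ← Finset.sum_fiberwise_of_maps_to (g := m) (t := s.image m)
      (fun b hb => Finset.mem_image_of_mem m hb)] at h2
    rw [← show _ = (0 : ℂ) from h2]
    refine Finset.sum_congr rfl fun l _ => ?_
    simp only [qexp, eval_finsetSum, Finset.sum_mul]
    refine Finset.sum_congr rfl fun b hb => ?_
    rw [← (Finset.mem_filter.1 hb).2]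
    simp [qexp, mul_assoc]
  have h3 := eq_zero_of_sum_qexp_eq_zero _ (fun l => ∑ b ∈ s with m b = l, c b • q b) h1 (m a)
    (Finset.mem_image_of_mem m ha)
  have h4 := linearIndependent_of_natDegree_injective (fun b : {b // m b = m a} => q b)
    (fun b => hq b) (by
      intro b b' hbb
      exact Subtype.ext (hinj (Prod.ext (b.2.trans b'.2.symm) hbb)))
  rw [linearIndependent_iff'] at h4
  refine h4 (s.subtype fun b => m b = m a) (fun b => c b) ?_ ⟨a, rfl⟩ (by simpa using ha)
  rw [← h3]
  exact Finset.sum_subtype_eq_sum_filter (fun b => c b • q b)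

/-! ### Operators with polynomial coefficients; existence of annihilators -/

/-- The differential operator `∑_{p ≤ N} A_p(x) ∂^p` applied to `f`. -/
def act (N : ℕ) (A : ℕ → ℂ[X]) (f : ℂ → ℂ) (x : ℂ) : ℂ :=
  ∑ p ∈ Finset.range (N + 1), (A p).eval x * iteratedDeriv p f x

lemma differentiable_iteratedDeriv {f : ℂ → ℂ} (hf : Differentiable ℂ f) (k : ℕ) :
    Differentiable ℂ (iteratedDeriv k f) := by
  induction k with
  | zero => simpa
  | succ k ih =>
    rw [iteratedDeriv_succ]
    exact ih.deriv

lemma hasDerivAt_iteratedDeriv {f : ℂ → ℂ} (hf : Differentiable ℂ f) (k : ℕ) (x : ℂ) :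
    HasDerivAt (iteratedDeriv k f) (iteratedDeriv (k + 1) f x) x := by
  rw [iteratedDeriv_succ]
  exact (differentiable_iteratedDeriv hf k x).hasDerivAt

lemma differentiable_act (N : ℕ) (A : ℕ → ℂ[X]) {f : ℂ → ℂ} (hf : Differentiable ℂ f) :
    Differentiable ℂ (act N A f) := by
  unfold act
  exact Differentiable.fun_sum fun p _ =>
    (A p).differentiable.mul (differentiable_iteratedDeriv hf p)

/-- The coefficients of `∂ ∘ ∑ c_p ∂^p`. -/
def derivCoeff (c : ℕ → ℂ[X]) : ℕ → ℂ[X]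
  | 0 => derivative (c 0)
  | j + 1 => derivative (c (j + 1)) + c j

lemma deriv_act (N : ℕ) (c : ℕ → ℂ[X]) (hc : ∀ j, N < j → c j = 0) {f : ℂ → ℂ}
    (hf : Differentiable ℂ f) : deriv (act N c f) = act (N + 1) (derivCoeff c) f := by
  funext x
  have h : HasDerivAt (act N c f) (∑ p ∈ Finset.range (N + 1),
      ((derivative (c p)).eval x * iteratedDeriv p f x
        + (c p).eval x * iteratedDeriv (p + 1) f x)) x := by
    unfold act
    exact HasDerivAt.fun_sum fun p _ =>
      ((c p).hasDerivAt x).mul (hasDerivAt_iteratedDeriv hf p x)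
  rw [h.deriv, act, Finset.sum_range_succ' _ (N + 1)]
  simp only [derivCoeff, eval_add, add_mul, Finset.sum_add_distrib]
  rw [Finset.sum_range_succ (fun p => (derivative (c (p + 1))).eval x * _), hc (N + 1) (by omega),
    Finset.sum_range_succ' (fun p => (derivative (c p)).eval x * _)]
  simp
  ring

/-- Expands ∂^k ∘ (p∂ - g), keeping track of the top coefficient and of the degree bound; this is
the composition step in `exists_annihilator`. -/
lemma exists_act_eq_iteratedDeriv (p g : ℂ[X]) (hg : g.natDegree ≤ p.natDegree) (k : ℕ) :
    ∃ b : ℕ → ℂ[X], (∀ j, k + 1 < j → b j = 0) ∧ b (k + 1) = p ∧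
      (∀ j, (b j).natDegree ≤ p.natDegree) ∧ ∀ f, Differentiable ℂ f →
      iteratedDeriv k (fun x => p.eval x * deriv f x - g.eval x * f x) = act (k + 1) b f := by
  induction k with
  | zero =>
    refine ⟨fun j => match j with | 0 => -g | 1 => p | _ => 0, ?_, rfl, ?_, ?_⟩
    · intro j hj
      match j, hj with
      | j + 2, _ => rfl
    · intro j
      match j with
      | 0 => simpa using hg
      | 1 => exact le_rfl
      | j + 2 => simp
    · intro f _
      funext x
      simp [act, Finset.sum_range_succ]
      ring
  | succ k ih =>
    obtain ⟨b, hb0, hb1, hb2, hb3⟩ := ih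
    refine ⟨derivCoeff b, ?_, ?_, ?_, ?_⟩
    · intro j hj
      match j, hj with
      | j + 1, hj => simp [derivCoeff, hb0 (j + 1) (by omega), hb0 j (by omega)]
    · simp [derivCoeff, hb0 (k + 2) (by omega), hb1]
    · intro j
      match j with
      | 0 => exact (natDegree_derivative_le _).trans (by have := hb2 0; omega)
      | j + 1 =>
        refine natDegree_add_le_of_degree_le ?_ (hb2 j)
        exact (natDegree_derivative_le _).trans (by have := hb2 (j + 1); omega)
    · intro f hf
      rw [iteratedDeriv_succ, hb3 f hf, deriv_act _ _ hb0 hf]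

/-- Any `N` quasi-polynomials are annihilated by an operator of order `N` whose coefficients have
degrees bounded by that of the leading one. -/
lemma exists_annihilator (N : ℕ) (q : Fin N → ℂ[X]) (l : Fin N → ℂ) :
    ∃ c : ℕ → ℂ[X], (∀ j, N < j → c j = 0) ∧ c N ≠ 0 ∧
      (∀ j, (c j).natDegree ≤ (c N).natDegree) ∧
      ∀ i x, act N c (qexp (q i) (l i)) x = 0 := by
  induction N with
  | zero =>
    refine ⟨fun j => if j = 0 then 1 else 0, ?_, by simp, ?_, fun i => i.elim0⟩
    · intro j hj
      simp [hj.ne']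
    · intro j
      by_cases hj : j = 0 <;> simp [hj]
  | succ N ih =>
    -- The first-order operator p∂ - g, with g = `expDeriv (l 0) p`, kills the first function. The
    -- induction hypothesis is then applied to the images of the others, and the operators are
    -- composed.
    obtain ⟨p, hp, hp0⟩ : ∃ p : ℂ[X], p ≠ 0 ∧
        p * expDeriv (l 0) (q 0) - expDeriv (l 0) p * q 0 = 0 := by
      by_cases h : q 0 = 0
      · exact ⟨1, one_ne_zero, by simp [h, expDeriv]⟩
      · exact ⟨q 0, h, by ring⟩
    set g := expDeriv (l 0) p with hg
    have hgd : g.natDegree ≤ p.natDegree := by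
      refine natDegree_add_le_of_degree_le ?_ (natDegree_C_mul_le _ _)
      exact (natDegree_derivative_le _).trans (by omega)
    obtain ⟨c, hc0, hc1, hc2, hc3⟩ := ih
      (fun i => p * expDeriv (l i.succ) (q i.succ) - g * q i.succ) (fun i => l i.succ)
    choose b hb0 hb1 hb2 hb3 using exists_act_eq_iteratedDeriv p g hgd
    have hq : ∀ i, (fun x => p.eval x * deriv (qexp (q i) (l i)) x - g.eval x * qexp (q i) (l i) x)
        = qexp (p * expDeriv (l i) (q i) - g * q i) (l i) := by
      intro i
      funext x
      rw [deriv_qexp]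
      simp only [qexp, eval_sub, eval_mul]
      ring
    have hlead : ∑ k ∈ Finset.range (N + 1), c k * b k (N + 1) = c N * p := by
      rw [Finset.sum_range_succ, Finset.sum_eq_zero, zero_add, hb1]
      intro k hk
      rw [hb0 k (N + 1) (by have := Finset.mem_range.1 hk; omega), mul_zero]
    refine ⟨fun j => ∑ k ∈ Finset.range (N + 1), c k * b k j, ?_, ?_, ?_, ?_⟩
    · intro j hj
      refine Finset.sum_eq_zero fun k hk => ?_
      rw [hb0 k j (by have := Finset.mem_range.1 hk; omega), mul_zero]
    · simpa only [hlead] using mul_ne_zero hc1 hp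
    · intro j
      simp only [hlead, natDegree_mul hc1 hp]
      refine natDegree_sum_le_of_forall_le _ _ fun k _ => ?_
      exact natDegree_mul_le.trans (add_le_add (hc2 k) (hb2 k j))
    · intro i x
      have h1 : act (N + 1) (fun j => ∑ k ∈ Finset.range (N + 1), c k * b k j)
          (qexp (q i) (l i)) x
          = act N c (qexp (p * expDeriv (l i) (q i) - g * q i) (l i)) x := by
        rw [← hq i]
        simp only [act, eval_finsetSum, Finset.sum_mul, eval_mul]
        rw [Finset.sum_comm]
        refine Finset.sum_congr rfl fun k hk => ?_
        rw [hb3 k _ (differentiable_qexp _ _), act, Finset.mul_sum]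
        have hk' := Finset.mem_range.1 hk
        symm
        refine (Finset.sum_subset (Finset.range_mono (show k + 1 + 1 ≤ N + 1 + 1 by omega)) ?_).trans
          (Finset.sum_congr rfl fun j _ => by ring)
        intro j _ hj
        rw [hb0 k j (by simpa using hj)]
        simp
      rw [h1]
      refine Fin.cases ?_ (fun i => ?_) i
      · rw [hp0]
        simp [act, iteratedDeriv_qexp, expDeriv_zero_iterate, qexp]
      · exact hc3 i x

/-! ### Spaces of quasi-polynomials as spans of families -/

lemma IsQuasiPolynomialSpace.exists_family {V : Submodule ℂ (ℂ → ℂ)}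
    (h : IsQuasiPolynomialSpace V) :
    ∃ (ι : Type) (_ : Fintype ι) (q : ι → ℂ[X]) (m : ι → ℂ), (∀ a, 0 < (q a).natDegree) ∧
      (Function.Injective fun a => (m a, (q a).natDegree)) ∧
      V = Submodule.span ℂ (Set.range fun a => qexp (q a) (m a)) := by
  obtain ⟨n, N, l, p, -, hl, hp, hmono, rfl⟩ := h
  refine ⟨(i : Fin n) × Fin (N i), inferInstance, fun a => p a.1 a.2, fun a => l a.1,
    fun a => hp _ _, ?_, rfl⟩
  rintro ⟨i, j⟩ ⟨i', j'⟩ hij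
  simp only [Prod.mk.injEq] at hij
  obtain rfl := hl hij.1
  obtain rfl := (hmono i).injective hij.2
  rfl

/-- The family is grouped by frequency, and within each group it is listed by increasing degree. -/
lemma isQuasiPolynomialSpace_of_family {ι : Type*} [Fintype ι] (q : ι → ℂ[X]) (m : ι → ℂ)
    (hq : ∀ a, 0 < (q a).natDegree)
    (hinj : Function.Injective fun a => (m a, (q a).natDegree)) :
    IsQuasiPolynomialSpace (Submodule.span ℂ (Set.range fun a => qexp (q a) (m a))) := by
  classical
  set S : Finset ℂ := Finset.univ.image m with hS
  set l : Fin S.card → ℂ := fun i => (S.equivFin.symm i : ℂ) with hl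
  set E : ℂ → Finset ℕ := fun z => (Finset.univ.filter fun a => m a = z).image
    fun a => (q a).natDegree with hE
  have hex : ∀ (i : Fin S.card) (j : Fin (E (l i)).card),
      ∃ a, m a = l i ∧ (q a).natDegree = (E (l i)).orderEmbOfFin rfl j := by
    intro i j
    have := (E (l i)).orderEmbOfFin_mem rfl j
    obtain ⟨a, ha, hd⟩ := Finset.mem_image.1 this
    exact ⟨a, (Finset.mem_filter.1 ha).2, hd⟩
  choose a ha1 ha2 using hex
  refine ⟨S.card, fun i => (E (l i)).card, l, fun i j => q (a i j), ?_, ?_, ?_, ?_, ?_⟩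
  · intro i
    have := (S.equivFin.symm i).2
    obtain ⟨b, -, hb⟩ := Finset.mem_image.1 this
    exact Finset.card_pos.2 ⟨_, Finset.mem_image.2 ⟨b, by simpa using hb, rfl⟩⟩
  · intro i j hij
    exact S.equivFin.symm.injective (Subtype.ext hij)
  · intro i j
    exact hq _
  · intro i j j' hjj
    simp only [ha2]
    exact ((E (l i)).orderEmbOfFin rfl).strictMono hjj
  · congr 1
    apply Set.Subset.antisymm
    · rintro _ ⟨b, rfl⟩
      obtain ⟨i, hi⟩ : ∃ i, l i = m b :=
        ⟨S.equivFin ⟨m b, Finset.mem_image_of_mem m (Finset.mem_univ b)⟩, by simp [hl]⟩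
      have hmem : (q b).natDegree ∈ E (l i) := by
        simp only [hE, Finset.mem_image, Finset.mem_filter]
        exact ⟨b, ⟨Finset.mem_univ _, hi.symm⟩, rfl⟩
      rw [← Finset.mem_coe, ← Finset.range_orderEmbOfFin (E (l i)) rfl] at hmem
      obtain ⟨j, hj⟩ := hmem
      have hab : a i j = b := hinj (Prod.ext ((ha1 i j).trans hi) ((ha2 i j).trans hj))
      refine ⟨⟨i, j⟩, ?_⟩
      simp only [hab, hi]
      rfl
    · rintro _ ⟨⟨i, j⟩, rfl⟩
      refine ⟨a i j, ?_⟩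
      simp only [ha1]
      rfl

lemma finrank_span_qexp {ι : Type*} [Fintype ι] (q : ι → ℂ[X]) (m : ι → ℂ)
    (hq : ∀ a, 0 < (q a).natDegree)
    (hinj : Function.Injective fun a => (m a, (q a).natDegree)) :
    Module.finrank ℂ (Submodule.span ℂ (Set.range fun a => qexp (q a) (m a))) = Fintype.card ι :=
  finrank_span_eq_card (linearIndependent_qexp q m (fun a h => by simpa [h] using hq a) hinj)

lemma IsQuasiPolynomialSpace.differentiable {V : Submodule ℂ (ℂ → ℂ)}
    (h : IsQuasiPolynomialSpace V) : ∀ f ∈ V, Differentiable ℂ f := by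
  obtain ⟨ι, _, q, m, -, -, rfl⟩ := h.exists_family
  intro f hf
  induction hf using Submodule.span_induction with
  | mem f hf =>
    obtain ⟨a, rfl⟩ := hf
    exact differentiable_qexp _ _
  | zero => exact differentiable_const 0
  | add f g _ _ hf hg => exact hf.add hg
  | smul c f _ hf => exact hf.const_smul c

lemma IsQuasiPolynomialSpace.finiteDimensional {V : Submodule ℂ (ℂ → ℂ)}
    (h : IsQuasiPolynomialSpace V) : FiniteDimensional ℂ V := by
  obtain ⟨ι, _, q, m, -, -, rfl⟩ := h.exists_family
  exact FiniteDimensional.span_of_finite ℂ (Set.finite_range _)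

/-- A pure exponential has degree 0, so adjoining it to the spanning family keeps the pairs
(frequency, degree) distinct and the family independent. -/
lemma IsQuasiPolynomialSpace.exp_notMem {V : Submodule ℂ (ℂ → ℂ)}
    (h : IsQuasiPolynomialSpace V) (μ : ℂ) : qexp 1 μ ∉ V := by
  obtain ⟨ι, _, q, m, hq, hinj, rfl⟩ := h.exists_family
  have h1 := linearIndependent_qexp (fun o : Option ι => o.elim 1 q) (fun o => o.elim μ m)
    (by
      rintro (_ | a)
      · exact one_ne_zero
      · exact fun h => by simpa [show q a = 0 from h] using hq a)
    (by
      rintro (_ | a) (_ | b) hab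
      · rfl
      · have := congrArg Prod.snd hab
        simp only [Option.elim, natDegree_one] at this
        exact absurd this (hq b).ne
      · have := congrArg Prod.snd hab
        simp only [Option.elim, natDegree_one] at this
        exact absurd this.symm (hq a).ne
      · exact congrArg some (hinj hab))
  rw [linearIndependent_option] at h1
  exact h1.2

/-! ### Local orders of solutions and the indicial polynomial -/

lemma act_add (N : ℕ) (A : ℕ → ℂ[X]) {f g : ℂ → ℂ} (hf : Differentiable ℂ f)
    (hg : Differentiable ℂ g) (x : ℂ) : act N A (f + g) x = act N A f x + act N A g x := by
  simp only [act, ← Finset.sum_add_distrib]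
  refine Finset.sum_congr rfl fun p _ => ?_
  rw [iteratedDeriv_add hf.contDiff.contDiffAt hg.contDiff.contDiffAt, mul_add]

lemma act_smul (N : ℕ) (A : ℕ → ℂ[X]) (c : ℂ) (f : ℂ → ℂ) (x : ℂ) :
    act N A (c • f) x = c * act N A f x := by
  simp only [act, Finset.mul_sum]
  refine Finset.sum_congr rfl fun p _ => ?_
  rw [iteratedDeriv_const_smul_field, smul_eq_mul]
  ring

/-- The derivatives of a function with a zero of order `e`, in terms of regular factors. -/
lemma exists_factor_iteratedDeriv {f : ℂ → ℂ} (hf : Differentiable ℂ f) {z : ℂ} {e : ℕ}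
    (he : analyticOrderAt f z = e) :
    ∃ (G : ℕ → ℂ → ℂ) (c : ℂ), c ≠ 0 ∧ (∀ k, AnalyticAt ℂ (G k) z) ∧
      (∀ k, G k z = c * (descPochhammer ℂ k).eval (e : ℂ)) ∧
      ∀ k, ∀ᶠ x in 𝓝 z, (x - z) ^ k * iteratedDeriv k f x = (x - z) ^ e * G k x := by
  obtain ⟨h, hh, hz, hfh⟩ := ((hf.analyticAt z).analyticOrderAt_eq_natCast).1 he
  let G : ℕ → ℂ → ℂ := fun k => Nat.rec h
    (fun k g x => (x - z) * deriv g x + ((e : ℂ) - k) * g x) k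
  have hG : ∀ k, G (k + 1) = fun x => (x - z) * deriv (G k) x + ((e : ℂ) - k) * G k x :=
    fun k => rfl
  have han : ∀ k, AnalyticAt ℂ (G k) z := by
    intro k
    induction k with
    | zero => exact hh
    | succ k ih =>
      rw [hG]
      have := ih.deriv
      fun_prop
  refine ⟨G, h z, hz, han, ?_, ?_⟩
  · intro k
    induction k with
    | zero => simp [G]
    | succ k ih =>
      rw [hG, descPochhammer_succ_eval, ← mul_assoc, ← ih]
      simp [mul_comm]
  · intro k
    induction k with
    | zero => simpa [G] using hfh
    | succ k ih =>
      have h1 : (fun x => (x - z) ^ k * iteratedDeriv k f x) =ᶠ[𝓝 z]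
        fun x => (x - z) ^ e * G k x := ih
      filter_upwards [h1.deriv, ih, (han k).eventually_analyticAt] with x hx1 hx2 hx3
      have hp : ∀ n : ℕ, HasDerivAt (fun x : ℂ => (x - z) ^ n) (n * (x - z) ^ (n - 1)) x := by
        intro n
        simpa using ((hasDerivAt_id x).sub_const z).fun_pow n
      have hp' : ∀ n : ℕ, (n : ℂ) * (x - z) ^ (n - 1) * (x - z) = n * (x - z) ^ n := by
        intro n
        cases n with
        | zero => simp
        | succ n => rw [Nat.add_sub_cancel, pow_succ, mul_assoc]
      rw [((hp k).fun_mul (hasDerivAt_iteratedDeriv hf k x)).deriv,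
        ((hp e).fun_mul hx3.differentiableAt.hasDerivAt).deriv] at hx1
      rw [hG]
      simp only
      linear_combination (x - z) * hx1 - k * hx2 - iteratedDeriv k f x * hp' k + G k x * hp' e

/-- The exponents of solutions are roots of the indicial polynomial. -/
lemma indicial_eq_zero {N s : ℕ} {A B : ℕ → ℂ[X]} {z : ℂ}
    (hAB : ∀ p ≤ N, (X - C z) ^ s * A p = (X - C z) ^ p * B p)
    {f : ℂ → ℂ} (hf : Differentiable ℂ f) (h0 : ∀ x, act N A f x = 0) {e : ℕ}
    (he : analyticOrderAt f z = e) :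
    ∑ p ∈ Finset.range (N + 1), (B p).eval z * (descPochhammer ℂ p).eval (e : ℂ) = 0 := by
  obtain ⟨G, c, hc, hG1, hG2, hG3⟩ := exists_factor_iteratedDeriv hf he
  have h1 : ∀ᶠ x in 𝓝 z, (x - z) ^ e * ∑ p ∈ Finset.range (N + 1), (B p).eval x * G p x = 0 := by
    have h2 : ∀ᶠ x in 𝓝 z, ∀ p ∈ Finset.range (N + 1),
        (x - z) ^ p * iteratedDeriv p f x = (x - z) ^ e * G p x :=
      (Finset.eventually_all _).2 fun p _ => hG3 p
    filter_upwards [h2] with x hx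
    have h3 := congrArg (fun y => (x - z) ^ s * y) (h0 x)
    simp only [act, mul_zero] at h3
    rw [← h3, Finset.mul_sum, Finset.mul_sum]
    refine Finset.sum_congr rfl fun p hp => ?_
    have h4 := congrArg (eval x) (hAB p (by have := Finset.mem_range.1 hp; omega))
    simp only [eval_mul, eval_pow, eval_sub, eval_X, eval_C] at h4
    linear_combination (-(B p).eval x) * hx p hp - iteratedDeriv p f x * h4
  have h5 : ContinuousAt (fun x => ∑ p ∈ Finset.range (N + 1), (B p).eval x * G p x) z :=
    tendsto_finsetSum _ fun p _ => (B p).continuous.continuousAt.mul (hG1 p).continuousAt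
  have h6 : ∀ᶠ x in 𝓝[≠] z, ∑ p ∈ Finset.range (N + 1), (B p).eval x * G p x = 0 := by
    filter_upwards [h1.filter_mono nhdsWithin_le_nhds, self_mem_nhdsWithin] with x hx hne
    exact (mul_eq_zero.1 hx).resolve_left (pow_ne_zero _ (sub_ne_zero.2 hne))
  have h7 := tendsto_nhds_unique (h5.mono_left nhdsWithin_le_nhds)
    ((Filter.tendsto_congr' h6).2 tendsto_const_nhds)
  simp only [hG2] at h7
  refine (mul_eq_zero.1 ?_).resolve_left hc
  rw [Finset.mul_sum, ← h7]
  exact Finset.sum_congr rfl fun p _ => by ring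

/-- At a regular point the indicial polynomial is A_N(z) e(e - 1)⋯(e - N + 1), whose natural roots
are those below N. -/
lemma analyticOrderAt_lt_of_act_eq_zero {N : ℕ} {A : ℕ → ℂ[X]} {z : ℂ} (hz : (A N).eval z ≠ 0)
    {f : ℂ → ℂ} (hf : Differentiable ℂ f) (h0 : ∀ x, act N A f x = 0) {e : ℕ}
    (he : analyticOrderAt f z = e) : e < N := by
  have h1 := indicial_eq_zero (s := N) (B := fun p => (X - C z) ^ (N - p) * A p) (z := z)
    (fun p hp => by rw [← mul_assoc, ← pow_add, Nat.add_sub_cancel' hp]) hf h0 he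
  rw [Finset.sum_range_succ, Finset.sum_eq_zero, zero_add] at h1
  · simp only [Nat.sub_self, pow_zero, one_mul, mul_eq_zero, hz, false_or,
      descPochhammer_eval_eq_descFactorial, Nat.cast_eq_zero,
      Nat.descFactorial_eq_zero_iff_lt] at h1
    exact h1
  · intro p hp
    have : N - p ≠ 0 := by have := Finset.mem_range.1 hp; omega
    simp [this]

lemma analyticOrderAt_ne_top_of_differentiable {f : ℂ → ℂ} (hf : Differentiable ℂ f) (hne : f ≠ 0)
    (z : ℂ) : analyticOrderAt f z ≠ ⊤ := by
  rw [Ne, analyticOrderAt_eq_top]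
  intro h
  apply hne
  exact AnalyticOnNhd.eq_of_eventuallyEq (f := f) (g := 0) (z₀ := z)
    (fun x _ => hf.analyticAt x) (fun x _ => analyticAt_const) h

/-- The linear map of derivatives at `z` of given orders on a space of entire functions. -/
def jet {V : Submodule ℂ (ℂ → ℂ)} (hV : ∀ f ∈ V, Differentiable ℂ f) (z : ℂ) {ι : Type*}
    (k : ι → ℕ) : V →ₗ[ℂ] (ι → ℂ) where
  toFun f i := iteratedDeriv (k i) (f : ℂ → ℂ) z
  map_add' f g := by
    funext i
    exact iteratedDeriv_add (hV _ f.2).contDiff.contDiffAt (hV _ g.2).contDiff.contDiffAt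
  map_smul' c f := by
    funext i
    exact iteratedDeriv_const_smul_field c (f : ℂ → ℂ)

/-- At a point where A_N does not vanish, a solution is determined by its first N derivatives. -/
lemma finrank_le_of_act_eq_zero {N : ℕ} {A : ℕ → ℂ[X]} (hA : A N ≠ 0)
    {V : Submodule ℂ (ℂ → ℂ)} (hV : ∀ f ∈ V, Differentiable ℂ f)
    (h0 : ∀ f ∈ V, ∀ x, act N A f x = 0) : FiniteDimensional ℂ V ∧ Module.finrank ℂ V ≤ N := by
  obtain ⟨z, hz⟩ : ∃ z, (A N).eval z ≠ 0 := by
    by_contra! h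
    exact hA (Polynomial.funext (by simpa using h))
  have hinj : Function.Injective (jet hV z fun i : Fin N => (i : ℕ)) := by
    rw [← LinearMap.ker_eq_bot, LinearMap.ker_eq_bot']
    intro f hf
    by_contra hne
    have hne' : (f : ℂ → ℂ) ≠ 0 := fun h => hne (Subtype.ext h)
    obtain ⟨e, he⟩ := WithTop.ne_top_iff_exists.1
      (analyticOrderAt_ne_top_of_differentiable (hV _ f.2) hne' z)
    have hlt := analyticOrderAt_lt_of_act_eq_zero hz (hV _ f.2) (h0 _ f.2) he.symm
    have := ((analyticOrderAt_eq_nat_iff_iteratedDeriv_eq_zero ((hV _ f.2).analyticAt z)).1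
      he.symm).2
    exact this (congrFun hf ⟨e, hlt⟩)
  refine ⟨FiniteDimensional.of_injective _ hinj, ?_⟩
  simpa using LinearMap.finrank_le_finrank_of_injective hinj

/-! ### The regularized fundamental operator -/

/-- `∑_{p ≤ N} A_p ∂^p` is a regularized fundamental operator of `V`: it annihilates `V`, its order
is `dim V`, its leading coefficient is monic of degree `M`, bounding the degrees of the other
coefficients, and the coefficients have no common zero. -/
structure IsRegularOp (N M : ℕ) (A : ℕ → ℂ[X]) (V : Submodule ℂ (ℂ → ℂ)) : Prop where
  differentiable : ∀ f ∈ V, Differentiable ℂ f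
  finiteDimensional : FiniteDimensional ℂ V
  finrank_eq : Module.finrank ℂ V = N
  act_eq_zero : ∀ f ∈ V, ∀ x, act N A f x = 0
  monic : (A N).Monic
  natDegree_eq : (A N).natDegree = M
  natDegree_le : ∀ p ≤ N, (A p).natDegree ≤ M
  exists_eval_ne_zero : ∀ z, ∃ p ≤ N, (A p).eval z ≠ 0

/-- The span of V and f still consists of solutions, so its dimension cannot exceed N = dim V. -/
lemma mem_of_act_eq_zero {N M : ℕ} {A : ℕ → ℂ[X]} {V : Submodule ℂ (ℂ → ℂ)}
    (h : IsRegularOp N M A V) {f : ℂ → ℂ} (hf : Differentiable ℂ f)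
    (h0 : ∀ x, act N A f x = 0) : f ∈ V := by
  have hfd := h.finiteDimensional
  have hd : ∀ g ∈ V ⊔ Submodule.span ℂ {f}, Differentiable ℂ g := by
    intro g hg
    obtain ⟨v, hv, w, hw, rfl⟩ := Submodule.mem_sup.1 hg
    obtain ⟨c, rfl⟩ := Submodule.mem_span_singleton.1 hw
    exact (h.differentiable v hv).add (hf.const_smul c)
  have hk : ∀ g ∈ V ⊔ Submodule.span ℂ {f}, ∀ x, act N A g x = 0 := by
    intro g hg x
    obtain ⟨v, hv, w, hw, rfl⟩ := Submodule.mem_sup.1 hg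
    obtain ⟨c, rfl⟩ := Submodule.mem_span_singleton.1 hw
    rw [act_add _ _ (h.differentiable v hv) (hf.const_smul c), act_smul, h.act_eq_zero v hv, h0,
      mul_zero, add_zero]
  obtain ⟨hfd', hle⟩ := finrank_le_of_act_eq_zero h.monic.ne_zero hd hk
  have := Submodule.eq_of_le_of_finrank_le (le_sup_left : V ≤ V ⊔ Submodule.span ℂ {f})
    (by rw [h.finrank_eq]; exact hle)
  rw [this]
  exact (le_sup_right : _ ≤ V ⊔ Submodule.span ℂ {f}) (Submodule.mem_span_singleton_self f)

lemma eq_of_act_eq_zero {N M : ℕ} {A : ℕ → ℂ[X]} {V W : Submodule ℂ (ℂ → ℂ)}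
    (h : IsRegularOp N M A V) (hW : ∀ f ∈ W, Differentiable ℂ f)
    (h0 : ∀ f ∈ W, ∀ x, act N A f x = 0) (hr : Module.finrank ℂ W = N) : W = V := by
  have := h.finiteDimensional
  refine Submodule.eq_of_le_of_finrank_le (fun f hf => mem_of_act_eq_zero h (hW f hf) (h0 f hf)) ?_
  rw [hr, h.finrank_eq]

/-- Among annihilators whose leading coefficient has the largest degree, take one of least leading
degree: a common root z could be divided out, contradicting minimality. Then normalize to a monic
leading coefficient. -/
lemma exists_isRegularOp {V : Submodule ℂ (ℂ → ℂ)} (h : IsQuasiPolynomialSpace V) :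
    ∃ N M A, IsRegularOp N M A V := by
  classical
  obtain ⟨ι, _, q, m, hq, hinj, hVeq⟩ := h.exists_family
  set N := Fintype.card ι with hN
  let Q : ℕ → Prop := fun d => ∃ c : ℕ → ℂ[X], c N ≠ 0 ∧ (c N).natDegree = d ∧
    (∀ p ≤ N, (c p).natDegree ≤ d) ∧ ∀ a x, act N c (qexp (q a) (m a)) x = 0
  have hQ : ∃ d, Q d := by
    obtain ⟨c, -, hc1, hc2, hc3⟩ := exists_annihilator N (fun i => q ((Fintype.equivFin ι).symm i))
      (fun i => m ((Fintype.equivFin ι).symm i))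
    exact ⟨_, c, hc1, rfl, fun p _ => hc2 p, fun a x => by simpa using hc3 (Fintype.equivFin ι a) x⟩
  obtain ⟨c, hc1, hc2, hc3, hc4⟩ := Nat.find_spec hQ
  have hprim : ∀ z, ∃ p ≤ N, (c p).eval z ≠ 0 := by
    intro z
    by_contra! hz
    have hdvd : ∀ p ≤ N, (X - C z) * (c p /ₘ (X - C z)) = c p := fun p hp =>
      mul_divByMonic_eq_iff_isRoot.2 (hz p hp)
    have hdeg : ∀ p, (c p /ₘ (X - C z)).natDegree = (c p).natDegree - 1 := fun p => by
      rw [natDegree_divByMonic _ (monic_X_sub_C z), natDegree_X_sub_C]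
    have hne : c N /ₘ (X - C z) ≠ 0 := fun h0 => hc1 (by rw [← hdvd N le_rfl, h0, mul_zero])
    have hpos : 0 < (c N).natDegree := by
      rw [← hdvd N le_rfl, natDegree_mul (X_sub_C_ne_zero z) hne, natDegree_X_sub_C]
      omega
    refine Nat.find_min hQ (m := Nat.find hQ - 1) (by omega)
      ⟨fun p => c p /ₘ (X - C z), hne, by rw [hdeg, hc2], fun p hp => ?_, fun a x => ?_⟩
    · rw [hdeg]
      exact Nat.sub_le_sub_right (hc3 p hp) 1
    · have hd := differentiable_act N (fun p => c p /ₘ (X - C z)) (differentiable_qexp (q a) (m a))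
      have h1 : ∀ x, (x - z) * act N (fun p => c p /ₘ (X - C z)) (qexp (q a) (m a)) x = 0 := by
        intro x
        rw [← hc4 a x, act, act, Finset.mul_sum]
        refine Finset.sum_congr rfl fun p hp => ?_
        conv_rhs => rw [← hdvd p (by have := Finset.mem_range.1 hp; omega)]
        simp [mul_assoc]
      have h2 : Set.EqOn (act N (fun p => c p /ₘ (X - C z)) (qexp (q a) (m a))) 0 {z}ᶜ := by
        intro x hx
        exact (mul_eq_zero.1 (h1 x)).resolve_left (sub_ne_zero.2 hx)
      exact congrFun (Continuous.ext_on (dense_compl_singleton z) hd.continuous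
        continuous_zero h2) x
  set lc := (c N).leadingCoeff with hlc
  have hlc0 : lc ≠ 0 := leadingCoeff_ne_zero.2 hc1
  have hdeg : ∀ p, (C lc⁻¹ * c p).natDegree = (c p).natDegree := fun p =>
    natDegree_C_mul (inv_ne_zero hlc0)
  refine ⟨N, Nat.find hQ, fun p => C lc⁻¹ * c p, h.differentiable, h.finiteDimensional, ?_, ?_, ?_,
    ?_, ?_, ?_⟩
  · rw [hVeq, finrank_span_qexp q m hq hinj]
  · have hact : ∀ f x, act N (fun p => C lc⁻¹ * c p) f x = lc⁻¹ * act N c f x := by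
      intro f x
      simp [act, Finset.mul_sum, mul_assoc]
    have hlin : ∀ f ∈ V, Differentiable ℂ f ∧ ∀ x, act N c f x = 0 := by
      rw [hVeq]
      intro f hf
      induction hf using Submodule.span_induction with
      | mem f hf =>
        obtain ⟨a, rfl⟩ := hf
        exact ⟨differentiable_qexp _ _, hc4 a⟩
      | zero => exact ⟨differentiable_const 0, fun x => by simp [act]⟩
      | add f g _ _ hf hg =>
        refine ⟨hf.1.add hg.1, fun x => ?_⟩
        rw [act_add _ _ hf.1 hg.1, hf.2, hg.2, add_zero]
      | smul a f _ hf =>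
        refine ⟨hf.1.const_smul a, fun x => ?_⟩
        rw [act_smul, hf.2, mul_zero]
    intro f hf x
    rw [hact, (hlin f hf).2, mul_zero]
  · simp [Monic, leadingCoeff_mul, ← hlc, hlc0]
  · rw [hdeg, hc2]
  · intro p hp
    rw [hdeg]
    exact hc3 p hp
  · intro z
    obtain ⟨p, hp, hpz⟩ := hprim z
    exact ⟨p, hp, by simpa [hlc0] using hpz⟩

/-! ### Exchanging x and ∂ -/

/-- The coefficients of the operator obtained by exchanging `x` and `∂`. -/
def swapOp (N : ℕ) (A : ℕ → ℂ[X]) (j : ℕ) : ℂ[X] :=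
  ∑ k ∈ Finset.range (N + 1), monomial k ((A k).coeff j)

lemma coeff_swapOp (N : ℕ) (A : ℕ → ℂ[X]) (j k : ℕ) :
    (swapOp N A j).coeff k = if k ≤ N then (A k).coeff j else 0 := by
  simp [swapOp, coeff_monomial]

/-- The degree bound M guarantees that no coefficient is truncated by the two exchanges. -/
lemma swapOp_swapOp {N M : ℕ} {A : ℕ → ℂ[X]} (hM : ∀ p ≤ N, (A p).natDegree ≤ M) {p : ℕ}
    (hp : p ≤ N) : swapOp M (swapOp N A) p = A p := by
  ext j
  rw [coeff_swapOp, coeff_swapOp, if_pos hp]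
  split_ifs with h
  · rfl
  · exact (coeff_eq_zero_of_natDegree_lt (by have := hM p hp; omega)).symm

lemma act_congr {N : ℕ} {A B : ℕ → ℂ[X]} (h : ∀ p ≤ N, A p = B p) (f : ℂ → ℂ) (x : ℂ) :
    act N A f x = act N B f x :=
  Finset.sum_congr rfl fun p hp => by rw [h p (by have := Finset.mem_range.1 hp; omega)]

lemma natDegree_swapOp_le (N : ℕ) (A : ℕ → ℂ[X]) (j : ℕ) : (swapOp N A j).natDegree ≤ N := by
  rw [natDegree_le_iff_coeff_eq_zero]
  intro k hk
  rw [coeff_swapOp, if_neg (by omega)]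

/-- Both sides are the symbol `∑ A_{jk} x^j u^k`. -/
lemma sum_eval_mul_pow_eq {N M : ℕ} {A : ℕ → ℂ[X]} (hM : ∀ p ≤ N, (A p).natDegree ≤ M) (x u : ℂ) :
    ∑ k ∈ Finset.range (N + 1), (A k).eval x * u ^ k
      = ∑ j ∈ Finset.range (M + 1), (swapOp N A j).eval u * x ^ j := by
  have h1 : ∀ j, (swapOp N A j).eval u
      = ∑ k ∈ Finset.range (N + 1), (A k).coeff j * u ^ k := by
    intro j
    simp [swapOp, eval_finsetSum]
  simp only [h1, Finset.sum_mul]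
  rw [Finset.sum_comm]
  refine Finset.sum_congr rfl fun k hk => ?_
  rw [eval_eq_sum_range' (n := M + 1)
    (by have := hM k (by have := Finset.mem_range.1 hk; omega); omega), Finset.sum_mul]
  exact Finset.sum_congr rfl fun j _ => by ring

lemma iteratedDeriv_exp_mul (u : ℂ) (k : ℕ) (x : ℂ) :
    iteratedDeriv k (fun x => Complex.exp (u * x)) x = u ^ k * Complex.exp (u * x) := by
  simp [iteratedDeriv_cexp_const_mul]

lemma act_exp (N : ℕ) (A : ℕ → ℂ[X]) (u x : ℂ) :
    act N A (fun x => Complex.exp (u * x)) x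
      = (∑ k ∈ Finset.range (N + 1), (A k).eval x * u ^ k) * Complex.exp (u * x) := by
  simp only [act, iteratedDeriv_exp_mul, Finset.sum_mul, mul_assoc]

/-- At a common zero μ the symbol vanishes identically in x, so e^{μx} is a solution and lies in V,
contrary to `exp_notMem`. -/
lemma IsRegularOp.exists_eval_swapOp_ne_zero {N M : ℕ} {A : ℕ → ℂ[X]}
    {V : Submodule ℂ (ℂ → ℂ)} (h : IsRegularOp N M A V) (hV : IsQuasiPolynomialSpace V) (μ : ℂ) :
    ∃ j ≤ M, (swapOp N A j).eval μ ≠ 0 := by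
  by_contra! hz
  have h1 : qexp 1 μ = fun x => Complex.exp (μ * x) := by
    funext x
    simp [qexp]
  refine hV.exp_notMem μ (mem_of_act_eq_zero h (differentiable_qexp _ _) fun x => ?_)
  rw [h1, act_exp, sum_eval_mul_pow_eq h.natDegree_le, Finset.sum_eq_zero, zero_mul]
  intro j hj
  rw [hz j (by have := Finset.mem_range.1 hj; omega), zero_mul]

lemma IsRegularOp.swap {N M : ℕ} {A : ℕ → ℂ[X]} {V U : Submodule ℂ (ℂ → ℂ)}
    (h : IsRegularOp N M A V) (hV : IsQuasiPolynomialSpace V) (hU : IsQuasiPolynomialSpace U)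
    (hr : Module.finrank ℂ U = M) (h0 : ∀ f ∈ U, ∀ x, act M (swapOp N A) f x = 0) :
    IsRegularOp M N (swapOp N A) U := by
  have hlead : (swapOp N A M).coeff N = 1 := by
    rw [coeff_swapOp, if_pos le_rfl, ← h.natDegree_eq]
    exact h.monic
  have hdeg : (swapOp N A M).natDegree = N := by
    refine le_antisymm (natDegree_swapOp_le _ _ _) (le_natDegree_of_ne_zero ?_)
    rw [hlead]
    exact one_ne_zero
  refine ⟨hU.differentiable, hU.finiteDimensional, hr, h0, ?_, hdeg,
    fun p _ => natDegree_swapOp_le _ _ _, h.exists_eval_swapOp_ne_zero hV⟩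
  rw [Monic, Polynomial.leadingCoeff, hdeg, hlead]

/-! ### Adapted bases, exponents and singular points -/

lemma linearIndependent_of_analyticOrderAt_injective {ι : Type*} {z : ℂ} {f : ι → ℂ → ℂ}
    {e : ι → ℕ} (hf : ∀ i, Differentiable ℂ (f i)) (he : ∀ i, analyticOrderAt (f i) z = e i)
    (hinj : Function.Injective e) : LinearIndependent ℂ f := by
  classical
  rw [linearIndependent_iff']
  intro s c h i hi
  by_contra hci
  obtain ⟨j, hj, hmin⟩ := (s.filter fun i => c i ≠ 0).exists_min_image e
    ⟨i, Finset.mem_filter.2 ⟨hi, hci⟩⟩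
  rw [Finset.mem_filter] at hj
  have h1 : iteratedDeriv (e j) (∑ i ∈ s, c i • f i) z = 0 := by
    rw [h]
    simp
  rw [iteratedDeriv_sum fun i _ => ((hf i).const_smul (c i)).contDiff.contDiffAt,
    Finset.sum_eq_single_of_mem j hj.1] at h1
  · rw [iteratedDeriv_const_smul_field, smul_eq_mul] at h1
    exact ((analyticOrderAt_eq_nat_iff_iteratedDeriv_eq_zero ((hf j).analyticAt z)).1 (he j)).2
      ((mul_eq_zero.1 h1).resolve_left hj.2)
  · intro k hk hkj
    rw [iteratedDeriv_const_smul_field, smul_eq_mul]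
    by_cases hck : c k = 0
    · rw [hck, zero_mul]
    · have hle := hmin k (Finset.mem_filter.2 ⟨hk, hck⟩)
      rw [((analyticOrderAt_eq_nat_iff_iteratedDeriv_eq_zero ((hf k).analyticAt z)).1 (he k)).1
        (e j) (lt_of_le_of_ne hle fun h => hkj (hinj h.symm)), mul_zero]

/-- `b` is a basis of `V` whose elements have pairwise distinct orders `e j` at `z`. -/
structure IsAdapted {V : Submodule ℂ (ℂ → ℂ)} {N : ℕ} (b : Module.Basis (Fin N) ℂ V) (z : ℂ)
    (e : Fin N → ℕ) : Prop where
  injective : Function.Injective e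
  order_eq : ∀ j, analyticOrderAt (b j : ℂ → ℂ) z = e j
  mem_range : ∀ f ∈ V, ∀ n : ℕ, analyticOrderAt f z = n → n ∈ Set.range e

/-- One function is chosen for each order that occurs. Distinct orders make them independent, and
the derivatives of these orders separate V, so there are exactly dim V of them. -/
lemma exists_isAdapted {V : Submodule ℂ (ℂ → ℂ)} (hV : ∀ f ∈ V, Differentiable ℂ f)
    [FiniteDimensional ℂ V] (z : ℂ) {N : ℕ} (hN : Module.finrank ℂ V = N) :
    ∃ (b : Module.Basis (Fin N) ℂ V) (e : Fin N → ℕ), IsAdapted b z e := by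
  classical
  let E : Set ℕ := {n | ∃ f ∈ V, analyticOrderAt f z = n}
  choose f hfV hf using fun n : E => n.2
  have hli : LinearIndependent ℂ (fun n : E => (⟨f n, hfV n⟩ : V)) := by
    have := linearIndependent_of_analyticOrderAt_injective (fun n => hV _ (hfV n)) hf
      Subtype.val_injective
    exact LinearIndependent.of_comp V.subtype this
  have hfin : Finite E := hli.finite
  have := Fintype.ofFinite E
  have hinj : Function.Injective (jet hV z fun n : E => (n : ℕ)) := by
    rw [← LinearMap.ker_eq_bot, LinearMap.ker_eq_bot']
    intro g hg
    by_contra hne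
    obtain ⟨n, hn⟩ := WithTop.ne_top_iff_exists.1 (analyticOrderAt_ne_top_of_differentiable
      (hV _ g.2) (fun h => hne (Subtype.ext h)) z)
    exact ((analyticOrderAt_eq_nat_iff_iteratedDeriv_eq_zero ((hV _ g.2).analyticAt z)).1
      hn.symm).2 (congrFun hg ⟨n, g, g.2, hn.symm⟩)
  have hcard : Fintype.card E = N := by
    refine le_antisymm (hN ▸ hli.fintype_card_le_finrank) ?_
    simpa [hN] using LinearMap.finrank_le_finrank_of_injective hinj
  let b₀ := basisOfLinearIndependentOfCardEqFinrank' _ hli (hcard.trans hN.symm)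
  let ε : E ≃ Fin N := Fintype.equivFinOfCardEq hcard
  refine ⟨b₀.reindex ε, fun j => (ε.symm j : ℕ), ?_, ?_, ?_⟩
  · exact Subtype.val_injective.comp ε.symm.injective
  · intro j
    simp only [Module.Basis.reindex_apply, b₀, coe_basisOfLinearIndependentOfCardEqFinrank']
    exact hf _
  · intro g hg n hn
    exact ⟨ε ⟨n, g, hg, hn⟩, by simp⟩

/-- The exponents of `V` at `z`: those below `s` all occur and `s` does not, where `N - s` is the
multiplicity of `z` as a root of the leading coefficient. -/
lemma IsRegularOp.exists_exponent_gap {N M : ℕ} {A : ℕ → ℂ[X]} {V : Submodule ℂ (ℂ → ℂ)}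
    (h : IsRegularOp N M A V) {z : ℂ} {b : Module.Basis (Fin N) ℂ V} {e : Fin N → ℕ}
    (hb : IsAdapted b z e) :
    ∃ s ≤ N, rootMultiplicity z (A N) = N - s ∧ (∀ n < s, n ∈ Set.range e) ∧
      s ∉ Set.range e := by
  classical
  have hX : ∀ k, (X - C z) ^ k ≠ 0 := fun k => pow_ne_zero _ (X_sub_C_ne_zero z)
  -- The least such s makes (x - z)^s D = ∑ (x - z)^p B_p ∂^p with the B_p polynomials not all zero
  -- at z, hence a nonzero indicial polynomial I.
  have hQ : ∃ s, ∀ p ≤ N, (X - C z) ^ (p - s) ∣ A p :=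
    ⟨N, fun p hp => by simp [Nat.sub_eq_zero_of_le hp]⟩
  set s := Nat.find hQ with hs
  have hsdvd : ∀ p ≤ N, (X - C z) ^ (p - s) ∣ A p := Nat.find_spec hQ
  have hsN : s ≤ N := Nat.find_min' hQ fun p hp => by simp [Nat.sub_eq_zero_of_le hp]
  have hB : ∀ p, ∃ B : ℂ[X], p ≤ N → (X - C z) ^ s * A p = (X - C z) ^ p * B := by
    intro p
    by_cases hp : p ≤ N
    · rcases le_total s p with hsp | hsp
      · obtain ⟨B, hB⟩ := hsdvd p hp
        exact ⟨B, fun _ => by rw [hB, ← mul_assoc, ← pow_add, Nat.add_sub_cancel' hsp]⟩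
      · exact ⟨(X - C z) ^ (s - p) * A p, fun _ => by
          rw [← mul_assoc, ← pow_add, Nat.add_sub_cancel' hsp]⟩
    · exact ⟨0, fun h => absurd h hp⟩
  choose B hB using hB
  have hBlt : ∀ p < s, (B p).eval z = 0 := by
    intro p hp
    have h1 : (X - C z) ^ (s - p) * A p = B p := by
      apply mul_left_cancel₀ (hX p)
      rw [← hB p (by omega), ← mul_assoc, ← pow_add, Nat.add_sub_cancel' hp.le]
    rw [← h1]
    simp [show s - p ≠ 0 by omega]
  have hBne : ∃ p ≤ N, (B p).eval z ≠ 0 := by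
    by_contra! hall
    rcases Nat.eq_zero_or_pos s with h0 | hpos
    · obtain ⟨p, hp, hpz⟩ := h.exists_eval_ne_zero z
      apply hpz
      have := hB p hp
      rw [h0, pow_zero, one_mul] at this
      rw [this, eval_mul, hall p hp, mul_zero]
    · refine Nat.find_min hQ (m := s - 1) (by omega) fun p hp => ?_
      rcases lt_or_ge p s with hlt | hge
      · simp [show p - (s - 1) = 0 by omega]
      · obtain ⟨B', hB'⟩ := dvd_iff_isRoot.2 (hall p hp)
        refine ⟨B', mul_left_cancel₀ (hX s) ?_⟩
        rw [hB p hp, hB', ← mul_assoc, ← mul_assoc, ← pow_succ, ← pow_add]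
        congr 2
        omega
  set I : ℂ[X] := ∑ p ∈ Finset.range (N + 1), (B p).eval z • descPochhammer ℂ p with hI
  have hdeg : ∀ p, (descPochhammer ℂ p).natDegree = p :=
    fun p => descPochhammer_natDegree ℂ p
  have hIne : I ≠ 0 := by
    intro h0
    obtain ⟨p, hp, hpz⟩ := hBne
    have hli := linearIndependent_of_natDegree_injective (fun p => descPochhammer ℂ p)
      (fun p => (monic_descPochhammer ℂ p).ne_zero) (fun p p' hpp => by simpa [hdeg] using hpp)
    rw [linearIndependent_iff'] at hli
    exact hpz (hli _ _ h0 p (Finset.mem_range.2 (by omega)))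
  have hIeval : ∀ x : ℂ, I.eval x
      = ∑ p ∈ Finset.range (N + 1), (B p).eval z * (descPochhammer ℂ p).eval x := by
    intro x
    simp [hI, eval_finsetSum]
  have hIroot : ∀ j, I.eval (e j : ℂ) = 0 := by
    intro j
    rw [hIeval]
    exact indicial_eq_zero hB (h.differentiable _ (b j).2) (h.act_eq_zero _ (b j).2) (hb.order_eq j)
  have hcast : Function.Injective fun j => (e j : ℂ) := Nat.cast_injective.comp hb.injective
  -- Otherwise I would have degree below N but N distinct roots, the exponents.
  have hBN : (B N).eval z ≠ 0 := by
    intro h0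
    apply hIne
    rcases Nat.eq_zero_or_pos N with hN | hN
    · simp [hI, hN, hN ▸ h0]
    refine eq_zero_of_natDegree_lt_card_of_eval_eq_zero I hcast hIroot ?_
    rw [Fintype.card_fin, hI, Finset.sum_range_succ, h0, zero_smul, add_zero]
    refine lt_of_le_of_lt (natDegree_sum_le_of_forall_le _ _ (n := N - 1) fun p hp => ?_) (by omega)
    refine (natDegree_smul_le _ _).trans ?_
    rw [hdeg]
    have := Finset.mem_range.1 hp
    omega
  have hIdeg : I.natDegree ≤ N := by
    refine natDegree_sum_le_of_forall_le _ _ fun p hp => (natDegree_smul_le _ _).trans ?_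
    rw [hdeg]
    have := Finset.mem_range.1 hp
    omega
  -- Since B_p(z) = 0 for p < s, each n < s is a root of I; a non-exponent among them would be root
  -- number N + 1.
  have hmem : ∀ n < s, n ∈ Set.range e := by
    intro n hn
    by_contra hne
    apply hIne
    refine eq_zero_of_natDegree_lt_card_of_eval_eq_zero I
      (f := fun o : Option (Fin N) => o.elim (n : ℂ) fun j => (e j : ℂ)) ?_ ?_ (by simp; omega)
    · rintro (_ | i) (_ | j) hij
      · rfl
      · exact absurd ⟨j, Nat.cast_injective hij.symm⟩ hne
      · exact absurd ⟨i, Nat.cast_injective hij⟩ hne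
      · exact congrArg some (hcast hij)
    · rintro (_ | j)
      · change I.eval (n : ℂ) = 0
        rw [hIeval]
        refine Finset.sum_eq_zero fun p _ => ?_
        rcases lt_or_ge p s with hlt | hge
        · rw [hBlt p hlt, zero_mul]
        · rw [descPochhammer_eval_eq_descFactorial,
            Nat.descFactorial_eq_zero_iff_lt.2 (hn.trans_le hge), Nat.cast_zero, mul_zero]
      · exact hIroot j
  refine ⟨s, hsN, ?_, hmem, ?_⟩
  · have h1 : A N = B N * (X - C z) ^ (N - s) := by
      apply mul_left_cancel₀ (hX s)
      rw [hB N le_rfl, mul_left_comm, ← pow_add, Nat.add_sub_cancel' hsN, mul_comm]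
    have hBN0 : B N ≠ 0 := fun h0 => hBN (by simp [h0])
    rw [h1, rootMultiplicity_mul_X_sub_C_pow hBN0, rootMultiplicity_eq_zero hBN, zero_add]
  · have hne : ((Finset.range (N + 1)).filter fun p => (A p).eval z ≠ 0).Nonempty := by
      obtain ⟨p, hp, hpz⟩ := h.exists_eval_ne_zero z
      exact ⟨p, Finset.mem_filter.2 ⟨Finset.mem_range.2 (by omega), hpz⟩⟩
    -- For the largest i with A_i(z) ≠ 0, a solution f of order i would satisfy A_i(z) f^{(i)}(z) =
    -- 0, so i is not an exponent. Divisibility gives i ≤ s, and all smaller values are exponents,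
    -- so i = s.
    obtain ⟨i, hi, hmax⟩ := Finset.exists_max_image _ id hne
    rw [Finset.mem_filter, Finset.mem_range] at hi
    have his : i ≤ s := by
      by_contra! hlt
      obtain ⟨B', hB'⟩ := hsdvd i (by omega)
      apply hi.2
      rw [hB']
      simp [show i - s ≠ 0 by omega]
    have hiE : i ∉ Set.range e := by
      rintro ⟨j, rfl⟩
      have ho := (analyticOrderAt_eq_nat_iff_iteratedDeriv_eq_zero
        ((h.differentiable _ (b j).2).analyticAt z)).1 (hb.order_eq j)
      have h0 := h.act_eq_zero _ (b j).2 z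
      rw [act, Finset.sum_eq_single_of_mem (e j) (Finset.mem_range.2 hi.1)] at h0
      · exact (mul_ne_zero hi.2 ho.2) h0
      · intro p hp hpe
        rcases lt_or_gt_of_ne hpe with hlt | hgt
        · rw [ho.1 p hlt, mul_zero]
        · by_cases hz : (A p).eval z = 0
          · rw [hz, zero_mul]
          · exact absurd (hmax p (Finset.mem_filter.2 ⟨hp, hz⟩)) (not_le.2 hgt)
    rcases lt_or_eq_of_le his with hlt | rfl
    · exact absurd (hmem i hlt) hiE
    · exact hiE

lemma exponents_eq {V : Submodule ℂ (ℂ → ℂ)} (hV : ∀ f ∈ V, Differentiable ℂ f) {N : ℕ}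
    {z : ℂ} {b : Module.Basis (Fin N) ℂ V} {e : Fin N → ℕ} (hb : IsAdapted b z e) :
    exponents V z = Set.range fun j => (e j : ℤ) := by
  ext n
  constructor
  · rintro ⟨f, hf, hn⟩
    rw [((hV f hf).analyticAt z).meromorphicOrderAt_eq] at hn
    cases ho : analyticOrderAt f z with
    | top => simp [ho] at hn
    | coe k =>
      obtain ⟨j, hj⟩ := hb.mem_range f hf k ho
      refine ⟨j, ?_⟩
      rw [ho] at hn
      have hn' : ((k : ℤ) : WithTop ℤ) = (n : WithTop ℤ) := hn
      rw [← WithTop.coe_inj.1 hn', ← hj]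
  · rintro ⟨j, rfl⟩
    refine ⟨b j, (b j).2, ?_⟩
    rw [((hV _ (b j).2).analyticAt z).meromorphicOrderAt_eq, hb.order_eq j]
    rfl

lemma IsRegularOp.mem_singularPoints_iff {N M : ℕ} {A : ℕ → ℂ[X]} {V : Submodule ℂ (ℂ → ℂ)}
    (h : IsRegularOp N M A V) (z : ℂ) : z ∈ singularPoints V ↔ (A N).IsRoot z := by
  have := h.finiteDimensional
  obtain ⟨b, e, hb⟩ := exists_isAdapted h.differentiable z h.finrank_eq
  obtain ⟨s, hsN, hmult, hmem, hs⟩ := h.exists_exponent_gap hb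
  rw [← rootMultiplicity_pos h.monic.ne_zero, hmult, singularPoints, Set.mem_ofPred_eq,
    exponents_eq h.differentiable hb, h.finrank_eq]
  constructor
  · intro hne
    by_contra hlt
    have hsN' : s = N := by omega
    subst hsN'
    apply hne
    have h1 : (Finset.univ.image e) = Finset.range s := by
      symm
      apply Finset.eq_of_subset_of_card_le
      · intro n hn
        obtain ⟨j, hj⟩ := hmem n (Finset.mem_range.1 hn)
        exact Finset.mem_image.2 ⟨j, Finset.mem_univ _, hj⟩
      · exact Finset.card_image_le.trans (by simp)
    ext n
    constructor
    · rintro ⟨j, rfl⟩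
      have : e j ∈ Finset.range s := h1 ▸ Finset.mem_image_of_mem e (Finset.mem_univ j)
      have := Finset.mem_range.1 this
      simp only [Set.mem_Ico]
      omega
    · rintro ⟨h0, hn⟩
      obtain ⟨j, hj⟩ := hmem n.toNat (by omega)
      exact ⟨j, by simp only [hj]; omega⟩
  · intro hlt heq
    have : (s : ℤ) ∈ Set.Ico (0 : ℤ) N := by
      simp only [Set.mem_Ico]
      omega
    rw [← heq] at this
    obtain ⟨j, hj⟩ := this
    exact hs ⟨j, Nat.cast_injective hj⟩

/-! ### Wronskians and the conjugate space -/

lemma analyticAt_det {n : ℕ} {M : ℂ → Matrix (Fin n) (Fin n) ℂ} {x : ℂ}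
    (h : ∀ i j, AnalyticAt ℂ (fun y => M y i j) x) : AnalyticAt ℂ (fun y => (M y).det) x := by
  simp only [Matrix.det_apply']
  exact Finset.analyticAt_fun_sum _ fun σ _ =>
    analyticAt_const.mul (Finset.analyticAt_fun_prod _ fun i _ => h _ _)

lemma analyticAt_inv_apply {n : ℕ} {M : ℂ → Matrix (Fin n) (Fin n) ℂ} {x : ℂ}
    (h : ∀ i j, AnalyticAt ℂ (fun y => M y i j) x) (h0 : (M x).det ≠ 0) (i j : Fin n) :
    AnalyticAt ℂ (fun y => (M y)⁻¹ i j) x := by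
  have hadj : AnalyticAt ℂ (fun y => (M y).adjugate i j) x := by
    simp only [Matrix.adjugate_apply]
    refine analyticAt_det fun a c => ?_
    by_cases ha : a = j
    · subst ha
      simp only [Matrix.updateRow_self]
      exact analyticAt_const
    · simp only [Matrix.updateRow_ne ha]
      exact h a c
  simp only [Matrix.inv_def, Ring.inverse_eq_inv', Matrix.smul_apply, smul_eq_mul]
  exact ((analyticAt_det h).inv h0).mul hadj

/-- The matrix of derivatives of orders `0, …, k - 1`. -/
def wrMatrix {m : ℕ} (k : ℕ) (f : Fin m → ℂ → ℂ) (x : ℂ) : Matrix (Fin m) (Fin k) ℂ :=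
  Matrix.of fun j i => iteratedDeriv (i : ℕ) (f j) x

lemma wrMatrix_apply {m k : ℕ} (f : Fin m → ℂ → ℂ) (x : ℂ) (j : Fin m) (i : Fin k) :
    wrMatrix k f x j i = iteratedDeriv (i : ℕ) (f j) x := rfl

lemma wronskian_eq_det {k : ℕ} (f : Fin k → ℂ → ℂ) (x : ℂ) :
    wronskian f x = (wrMatrix k f x).det := rfl

lemma analyticAt_wrMatrix {m k : ℕ} {f : Fin m → ℂ → ℂ} (hf : ∀ j, Differentiable ℂ (f j)) (x : ℂ)
    (j : Fin m) (i : Fin k) : AnalyticAt ℂ (fun y => wrMatrix k f y j i) x :=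
  (differentiable_iteratedDeriv (hf j) i).analyticAt x

lemma analyticAt_wronskian {k : ℕ} {f : Fin k → ℂ → ℂ} (hf : ∀ j, Differentiable ℂ (f j)) (x : ℂ) :
    AnalyticAt ℂ (wronskian f) x :=
  analyticAt_det (analyticAt_wrMatrix hf x)

/-- Row j contributes (x - z)^{e_j} and column i contributes (x - z)^{-i}. At z the remaining
determinant is a nonzero multiple of the Vandermonde determinant of the exponents. -/
lemma meromorphicOrderAt_wronskian {k : ℕ} {f : Fin k → ℂ → ℂ} (hf : ∀ j, Differentiable ℂ (f j))
    {z : ℂ} {e : Fin k → ℕ} (he : ∀ j, analyticOrderAt (f j) z = e j)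
    (hinj : Function.Injective e) :
    meromorphicOrderAt (wronskian f) z = ((∑ i, ((e i : ℤ) - (i : ℕ)) : ℤ) : WithTop ℤ) := by
  choose G c hc hG1 hG2 hG3 using fun j => exists_factor_iteratedDeriv (hf j) (he j)
  rw [meromorphicOrderAt_eq_int_iff (analyticAt_wronskian hf z).meromorphicAt]
  refine ⟨fun x => (Matrix.of fun j i : Fin k => G j i x).det,
    analyticAt_det fun j i => hG1 j i, ?_, ?_⟩
  · simp only [hG2]
    have h1 := Matrix.det_mul_column c
      (Matrix.of fun j i : Fin k => (descPochhammer ℂ (i : ℕ)).eval (e j : ℂ))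
    simp only [Matrix.of_apply] at h1
    rw [h1, ← Matrix.det_eval_matrixOfPolynomials_eq_det_vandermonde (fun j => (e j : ℂ))
      (fun i => descPochhammer ℂ (i : ℕ)) (fun i => descPochhammer_natDegree ℂ _)
      (fun i => monic_descPochhammer ℂ _)]
    refine mul_ne_zero (Finset.prod_ne_zero_iff.2 fun j _ => hc j) ?_
    rw [Matrix.det_vandermonde_ne_zero_iff]
    exact Nat.cast_injective.comp hinj
  · have h2 : ∀ᶠ x in 𝓝 z, ∀ j i : Fin k,
        (x - z) ^ (i : ℕ) * iteratedDeriv (i : ℕ) (f j) x = (x - z) ^ e j * G j i x := by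
      simp only [Filter.eventually_all]
      exact fun j i => hG3 j i
    filter_upwards [h2.filter_mono nhdsWithin_le_nhds, self_mem_nhdsWithin] with x hx hne
    have ht : x - z ≠ 0 := sub_ne_zero.2 hne
    have h3 := Matrix.det_mul_row (fun i : Fin k => (x - z) ^ (i : ℕ)) (wrMatrix k f x)
    have h4 := Matrix.det_mul_column (fun j : Fin k => (x - z) ^ e j)
      (Matrix.of fun j i : Fin k => G j i x)
    simp only [wrMatrix_apply, hx] at h3
    simp only [Matrix.of_apply] at h4
    rw [h4, ← wronskian_eq_det, Finset.prod_pow_eq_pow_sum, Finset.prod_pow_eq_pow_sum] at h3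
    rw [Finset.sum_sub_distrib, zpow_sub₀ ht, ← Nat.cast_sum, ← Nat.cast_sum, zpow_natCast,
      zpow_natCast, smul_eq_mul, div_mul_eq_mul_div, h3]
    field_simp

section Basis

variable {V : Submodule ℂ (ℂ → ℂ)} {N : ℕ}

/-- The functions underlying a basis. -/
def basisFun (b : Module.Basis (Fin N) ℂ V) (j : Fin N) : ℂ → ℂ := (b j : ℂ → ℂ)

lemma wrMatrix_eq_mul (hV : ∀ f ∈ V, Differentiable ℂ f) (b : Module.Basis (Fin N) ℂ V)
    {m : ℕ} (k : ℕ) (g : Fin m → V) (x : ℂ) :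
    wrMatrix k (fun j => (g j : ℂ → ℂ)) x
      = (Matrix.of fun j i => b.repr (g j) i) * wrMatrix k (basisFun b) x := by
  ext j i
  have h : jet hV x (fun i : Fin k => (i : ℕ)) (g j) i
      = ∑ l, b.repr (g j) l * jet hV x (fun i : Fin k => (i : ℕ)) (b l) i := by
    conv_lhs => rw [← b.sum_repr (g j)]
    rw [map_sum, Finset.sum_apply]
    simp only [map_smul, Pi.smul_apply, smul_eq_mul]
  rw [Matrix.mul_apply]
  exact h

lemma wronskian_basis_eq (hV : ∀ f ∈ V, Differentiable ℂ f) (b b' : Module.Basis (Fin N) ℂ V) :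
    ∃ d : ℂ, d ≠ 0 ∧ ∀ x, wronskian (basisFun b') x = d * wronskian (basisFun b) x := by
  refine ⟨(Matrix.of fun j i => b.repr (b' j) i).det, ?_, fun x => ?_⟩
  · have h1 : (Matrix.of fun j i => b.repr (b' j) i) = (b.toMatrix b').transpose := rfl
    rw [h1, Matrix.det_transpose]
    have := b.invertibleToMatrix b'
    exact (Matrix.isUnit_det_of_invertible (b.toMatrix b')).ne_zero
  · rw [wronskian_eq_det, wronskian_eq_det, ← Matrix.det_mul, ← wrMatrix_eq_mul hV]
    rfl

lemma eventually_wronskian_ne_zero (hV : ∀ f ∈ V, Differentiable ℂ f) [FiniteDimensional ℂ V]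
    (b : Module.Basis (Fin N) ℂ V) (z : ℂ) :
    ∀ᶠ x in 𝓝[≠] z, wronskian (basisFun b) x ≠ 0 := by
  obtain ⟨b', e, hb⟩ := exists_isAdapted hV z
    (show Module.finrank ℂ V = N by simpa using Module.finrank_eq_card_basis b)
  obtain ⟨d, hd, h⟩ := wronskian_basis_eq hV b' b
  have hd' : ∀ j, Differentiable ℂ (basisFun b' j) := fun j => hV _ (b' j).2
  have h1 := meromorphicOrderAt_wronskian hd' hb.order_eq hb.injective
  have h2 := (meromorphicOrderAt_ne_top_iff_eventually_ne_zero
    (analyticAt_wronskian hd' z).meromorphicAt).1 (by rw [h1]; exact WithTop.coe_ne_top)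
  filter_upwards [h2] with x hx
  rw [h]
  exact mul_ne_zero hd hx

/-- Replaces the index type `Fin (Module.finrank ℂ V)` by `Fin N`, avoiding rewriting inside
dependent types. -/
lemma conjugate_eq_of_finrank (hN : Module.finrank ℂ V = N) :
    conjugate V = Submodule.span ℂ {g | ∃ b : Module.Basis (Fin N) ℂ V,
      ∃ k : ℕ, k + 1 = N ∧ ∃ f : Fin k → ℂ → ℂ, (∀ j, f j ∈ V) ∧
      g = fun x => wronskian f x / wronskian (basisFun b) x} := by
  subst hN
  rfl

lemma poleOrder_eq_of_finrank (hN : Module.finrank ℂ V = N) (z : ℂ) :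
    poleOrder V z = sInf {k : ℕ | ∃ b : Module.Basis (Fin N) ℂ V,
      ∀ p, 0 ≤ meromorphicOrderAt
        (fun x => (x - z) ^ k * monicCoeff (basisFun b) p x) z} := by
  subst hN
  rfl

end Basis

section Dual

variable {V : Submodule ℂ (ℂ → ℂ)} {n : ℕ}

/-- The basis of the conjugate space dual to a basis of `V`. -/
def dualFun (b : Module.Basis (Fin (n + 1)) ℂ V) (j : Fin (n + 1)) (x : ℂ) : ℂ :=
  (wrMatrix (n + 1) (basisFun b) x)⁻¹ (Fin.last n) j

/-- Cramer's rule for the last row of the inverse; at zeros of the Wronskian both sides are 0 by the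
conventions for inverses. -/
lemma dualFun_eq (b : Module.Basis (Fin (n + 1)) ℂ V) (j : Fin (n + 1)) (x : ℂ) :
    dualFun b j x = (-1) ^ ((j : ℕ) + n) *
      (wronskian (fun i => basisFun b (j.succAbove i)) x / wronskian (basisFun b) x) := by
  have h : (wrMatrix (n + 1) (basisFun b) x).submatrix j.succAbove (Fin.last n).succAbove
      = wrMatrix n (fun i => basisFun b (j.succAbove i)) x := by
    ext a c
    simp [wrMatrix_apply]
  rw [dualFun, Matrix.inv_def, Matrix.smul_apply, Matrix.adjugate_fin_succ_eq_det_submatrix, h,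
    Ring.inverse_eq_inv', wronskian_eq_det, wronskian_eq_det, smul_eq_mul, Fin.val_last]
  ring

lemma meromorphicAt_dualFun (hV : ∀ f ∈ V, Differentiable ℂ f)
    (b : Module.Basis (Fin (n + 1)) ℂ V) (j : Fin (n + 1)) (z : ℂ) :
    MeromorphicAt (dualFun b j) z := by
  rw [funext (dualFun_eq b j)]
  exact (MeromorphicAt.const _ z).mul
    ((analyticAt_wronskian (fun i => hV _ (b _).2) z).meromorphicAt.div
      (analyticAt_wronskian (fun i => hV _ (b i).2) z).meromorphicAt)

/-- In the quotient of Wronskians everything cancels except the exponent e_j of the deleted row and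
the order n of the deleted column. -/
lemma meromorphicOrderAt_dualFun (hV : ∀ f ∈ V, Differentiable ℂ f)
    {b : Module.Basis (Fin (n + 1)) ℂ V} {z : ℂ} {e : Fin (n + 1) → ℕ} (hb : IsAdapted b z e)
    (j : Fin (n + 1)) :
    meromorphicOrderAt (dualFun b j) z = (((n : ℤ) - e j : ℤ) : WithTop ℤ) := by
  have hd : ∀ i, Differentiable ℂ (basisFun b i) := fun i => hV _ (b i).2
  have h1 := meromorphicOrderAt_wronskian hd hb.order_eq hb.injective
  have h2 := meromorphicOrderAt_wronskian (fun i => hd (j.succAbove i))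
    (fun i => hb.order_eq (j.succAbove i)) (hb.injective.comp Fin.succAbove_right_injective)
  have hm1 := (analyticAt_wronskian hd z).meromorphicAt
  have hm2 := (analyticAt_wronskian (fun i => hd (j.succAbove i)) z).meromorphicAt
  have hc : (fun x => dualFun b j x) = fun x => (-1) ^ ((j : ℕ) + n) *
      (wronskian (fun i => basisFun b (j.succAbove i)) / wronskian (basisFun b)) x :=
    funext (dualFun_eq b j)
  rw [show dualFun b j = _ from hc]
  have h3 := meromorphicOrderAt_mul_of_ne_zero
    (f := wronskian (fun i => basisFun b (j.succAbove i)) / wronskian (basisFun b))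
    (analyticAt_const (v := ((-1 : ℂ) ^ ((j : ℕ) + n))) (x := z))
    (pow_ne_zero _ (neg_ne_zero.2 one_ne_zero))
  refine h3.trans ?_
  rw [meromorphicOrderAt_div hm2 hm1, h1, h2, ← WithTop.LinearOrderedAddCommGroup.coe_sub]
  congr 1
  simp only [Finset.sum_sub_distrib]
  rw [Fin.sum_univ_succAbove (fun i => (e i : ℤ)) j,
    Fin.sum_univ_castSucc (fun i : Fin (n + 1) => ((i : ℕ) : ℤ))]
  simp only [Fin.val_castSucc, Fin.val_last]
  ring

lemma conjugate_eq_span_dualFun (hV : ∀ f ∈ V, Differentiable ℂ f)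
    (b : Module.Basis (Fin (n + 1)) ℂ V) :
    conjugate V = Submodule.span ℂ (Set.range (dualFun b)) := by
  rw [conjugate_eq_of_finrank (show Module.finrank ℂ V = n + 1 by
    simpa using Module.finrank_eq_card_basis b)]
  apply le_antisymm
  · rw [Submodule.span_le]
    rintro _ ⟨b', k, hk, f, hf, rfl⟩
    obtain rfl : k = n := by omega
    obtain ⟨d, hd, hdet⟩ := wronskian_basis_eq hV b b'
    let g : Fin k → V := fun j => ⟨f j, hf j⟩
    let M : Matrix (Fin k) (Fin (k + 1)) ℂ := Matrix.of fun j i => b.repr (g j) i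
    have hM : ∀ x, wrMatrix (k + 1) f x = M * wrMatrix (k + 1) (basisFun b) x :=
      wrMatrix_eq_mul hV b (k + 1) g
    have key : (fun x => wronskian f x / wronskian (basisFun b') x)
        = ∑ j : Fin (k + 1), (d⁻¹ * ((-1) ^ (k + (j : ℕ)) * (M.submatrix id j.succAbove).det)) •
          dualFun b j := by
      funext x
      rw [Finset.sum_apply]
      simp only [Pi.smul_apply, smul_eq_mul, hdet]
      by_cases h0 : wronskian (basisFun b) x = 0
      · have hw : ∀ j, dualFun b j x = 0 := fun j => by rw [dualFun_eq, h0, div_zero, mul_zero]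
        simp [h0, hw]
      · set F := wrMatrix (k + 1) (basisFun b) x with hF
        have hu : IsUnit F.det := isUnit_iff_ne_zero.2 h0
        -- Appending the dual row to M makes the last row of M'F equal to (0, …, 0, 1), so det(M'F)
        -- = Wr(f). Expanding det M' along that row writes Wr(f)/Wr as a combination of the dual
        -- functions.
        let M' : Matrix (Fin (k + 1)) (Fin (k + 1)) ℂ := Matrix.of
          (Fin.snoc (α := fun _ => Fin (k + 1) → ℂ) M (fun j => dualFun b j x))
        have hcs : ∀ a, M' (Fin.castSucc a) = M a := fun a =>
          Fin.snoc_castSucc (α := fun _ => Fin (k + 1) → ℂ) ..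
        have hla : M' (Fin.last k) = fun j => dualFun b j x :=
          Fin.snoc_last (α := fun _ => Fin (k + 1) → ℂ) ..
        have h1 : M'.det = ∑ j : Fin (k + 1), (-1) ^ (k + (j : ℕ)) * dualFun b j x
            * (M.submatrix id j.succAbove).det := by
          rw [Matrix.det_succ_row M' (Fin.last k)]
          refine Finset.sum_congr rfl fun j _ => ?_
          rw [hla, Fin.val_last]
          congr 2
          ext a c
          simp [hcs]
        have hlast : ∀ j, (M' * F) (Fin.last k) j = (1 : Matrix (Fin (k + 1)) (Fin (k + 1)) ℂ)
            (Fin.last k) j := by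
          intro j
          rw [← Matrix.nonsing_inv_mul F hu, Matrix.mul_apply, Matrix.mul_apply, hla]
          rfl
        have h2 : (M' * F).det = wronskian f x := by
          rw [Matrix.det_succ_row _ (Fin.last k), Finset.sum_eq_single_of_mem (Fin.last k)
            (Finset.mem_univ _), hlast, Matrix.one_apply_eq, Fin.val_last, ← two_mul, pow_mul]
          · simp only [even_two, Even.neg_pow, one_pow, one_mul]
            rw [wronskian_eq_det]
            congr 1
            ext a c
            have := congrFun (congrFun (hM x) a) c.castSucc
            rw [Matrix.mul_apply] at this
            simp only [Fin.succAbove_last, Matrix.submatrix_apply, Matrix.mul_apply, hcs]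
            exact this.symm
          · intro j _ hj
            rw [hlast, Matrix.one_apply_ne hj.symm]
            ring
        have h3 : wronskian f x = M'.det * wronskian (basisFun b) x := by
          rw [← h2, Matrix.det_mul, wronskian_eq_det]
        rw [h3, h1, mul_div_mul_right _ _ h0, div_eq_inv_mul, Finset.mul_sum]
        exact Finset.sum_congr rfl fun j _ => by ring
    rw [key]
    exact Submodule.sum_mem _ fun j _ =>
      Submodule.smul_mem _ _ (Submodule.subset_span (Set.mem_range_self j))
  · rw [Submodule.span_le]
    rintro _ ⟨j, rfl⟩
    have h1 : dualFun b j = ((-1 : ℂ) ^ ((j : ℕ) + n)) •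
        fun x => wronskian (fun i => basisFun b (j.succAbove i)) x / wronskian (basisFun b) x :=
      funext fun x => dualFun_eq b j x
    rw [h1]
    exact Submodule.smul_mem _ _ (Submodule.subset_span
      ⟨b, n, rfl, _, fun i => (b _).2, rfl⟩)

end Dual

/-! ### Pole orders and the leading coefficient -/

section Coefficients

variable {V : Submodule ℂ (ℂ → ℂ)} {N M : ℕ} {A : ℕ → ℂ[X]}

/-- Laplace expansion of a determinant with row j repeated. -/
lemma sum_wronskianOmit_eq_zero {k : ℕ} (f : Fin k → ℂ → ℂ) (j : Fin k) (x : ℂ) :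
    ∑ p : Fin (k + 1), (-1) ^ (p : ℕ) * iteratedDeriv (p : ℕ) (f j) x * wronskianOmit f p x
      = 0 := by
  let T : Matrix (Fin (k + 1)) (Fin (k + 1)) ℂ := Matrix.of
    (Fin.cons (α := fun _ => Fin (k + 1) → ℂ) (wrMatrix (k + 1) f x j) (wrMatrix (k + 1) f x))
  have h0 : T.det = 0 :=
    Matrix.det_zero_of_row_eq (i := 0) (j := j.succ) (Fin.succ_ne_zero j).symm rfl
  rw [Matrix.det_succ_row_zero] at h0
  rw [← h0]
  rfl

/-- Cross-multiplying the two annihilators cancels the top terms. The difference has order below N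
and kills N functions with nonzero Wronskian, so it is zero at x. -/
lemma IsRegularOp.monicCoeff_eq (h : IsRegularOp N M A V) (b : Module.Basis (Fin N) ℂ V) {x : ℂ}
    (hW : wronskian (basisFun b) x ≠ 0) (hP : (A N).eval x ≠ 0) (p : Fin (N + 1)) :
    monicCoeff (basisFun b) p x = (A p).eval x / (A N).eval x := by
  set W := wronskian (basisFun b) x with hWdef
  let d : Fin (N + 1) → ℂ := fun p => (A p).eval x * W
    - (A N).eval x * ((-1) ^ (N - (p : ℕ)) * wronskianOmit (basisFun b) p x)
  have hsign : ∀ p : Fin (N + 1), (-1 : ℂ) ^ (N - (p : ℕ)) = (-1) ^ N * (-1) ^ (p : ℕ) := by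
    intro p
    obtain ⟨q, hq⟩ := Nat.exists_eq_add_of_le (Nat.lt_succ_iff.1 p.2)
    rw [← pow_add, show N - (p : ℕ) = q by omega, show N + (p : ℕ) = 2 * p + q by omega, pow_add,
      pow_mul]
    simp
  have hlast : d (Fin.last N) = 0 := by
    have : wronskianOmit (basisFun b) (Fin.last N) x = W := by
      rw [hWdef, wronskianOmit, wronskian]
      simp
    simp [d, this]
  have hsum : ∀ j, ∑ p, d p * iteratedDeriv (p : ℕ) (basisFun b j) x = 0 := by
    intro j
    have h1 := h.act_eq_zero _ (b j).2 x
    rw [act, Finset.sum_range] at h1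
    have h2 := sum_wronskianOmit_eq_zero (basisFun b) j x
    have h3 : ∑ p, d p * iteratedDeriv (p : ℕ) (basisFun b j) x
        = W * (∑ p : Fin (N + 1), (A p).eval x * iteratedDeriv (p : ℕ) (basisFun b j) x)
          - (A N).eval x * (-1) ^ N * ∑ p : Fin (N + 1), (-1) ^ (p : ℕ) *
            iteratedDeriv (p : ℕ) (basisFun b j) x * wronskianOmit (basisFun b) p x := by
      rw [Finset.mul_sum, Finset.mul_sum, ← Finset.sum_sub_distrib]
      refine Finset.sum_congr rfl fun p _ => ?_
      simp only [d, hsign]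
      ring
    rw [h3, h2, show ∑ p : Fin (N + 1), (A p).eval x * iteratedDeriv (p : ℕ) (basisFun b j) x = 0
      from h1]
    ring
  have hd : d = 0 := by
    have h4 : (fun i : Fin N => d i.castSucc) = 0 := by
      refine Matrix.eq_zero_of_mulVec_eq_zero (M := wrMatrix N (basisFun b) x) hW ?_
      funext j
      have := hsum j
      rw [Fin.sum_univ_castSucc, hlast, zero_mul, add_zero] at this
      simp only [Matrix.mulVec, dotProduct, wrMatrix_apply, Pi.zero_apply]
      rw [← this]
      exact Finset.sum_congr rfl fun i _ => mul_comm _ _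
    funext p
    exact Fin.lastCases hlast (fun i => congrFun h4 i) p
  have hp := congrFun hd p
  simp only [d, Pi.zero_apply] at hp
  rw [monicCoeff, eq_div_iff hP, ← hWdef]
  field_simp
  linear_combination -hp

/-- The monic coefficients are A_p / A_N, and some A_p does not vanish at z, so the full
multiplicity of the root of A_N is needed. -/
lemma IsRegularOp.poleOrder_eq (h : IsRegularOp N M A V) (z : ℂ) :
    poleOrder V z = rootMultiplicity z (A N) := by
  have hfd := h.finiteDimensional
  obtain ⟨R, hR, hRz⟩ := exists_eq_pow_rootMultiplicity_mul_and_not_dvd (A N) h.monic.ne_zero z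
  rw [dvd_iff_isRoot, IsRoot.def] at hRz
  set m := rootMultiplicity z (A N) with hm
  have han : ∀ p, AnalyticAt ℂ (fun x => (A p).eval x / R.eval x) z := fun p =>
    ((A p).differentiable.analyticAt z).div (R.differentiable.analyticAt z) hRz
  have hev : ∀ (b : Module.Basis (Fin N) ℂ V) (k : ℕ) (p : Fin (N + 1)),
      (fun x => (x - z) ^ k * monicCoeff (basisFun b) p x) =ᶠ[𝓝[≠] z]
        fun x => (x - z) ^ ((k : ℤ) - m) • ((A p).eval x / R.eval x) := by
    intro b k p
    have hRev : ∀ᶠ x in 𝓝 z, R.eval x ≠ 0 := R.continuous.continuousAt.eventually_ne hRz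
    filter_upwards [eventually_wronskian_ne_zero h.differentiable b z, self_mem_nhdsWithin,
      hRev.filter_mono nhdsWithin_le_nhds] with x hx hne hRx
    have ht : x - z ≠ 0 := sub_ne_zero.2 hne
    have hPx : (A N).eval x = (x - z) ^ m * R.eval x := by
      conv_lhs => rw [hR]
      simp
    rw [h.monicCoeff_eq b hx (by rw [hPx]; exact mul_ne_zero (pow_ne_zero _ ht) hRx), hPx,
      zpow_sub₀ ht, zpow_natCast, zpow_natCast, smul_eq_mul]
    field_simp
  have hset : {k : ℕ | ∃ b : Module.Basis (Fin N) ℂ V, ∀ p, 0 ≤ meromorphicOrderAt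
      (fun x => (x - z) ^ k * monicCoeff (basisFun b) p x) z} = Set.Ici m := by
    ext k
    constructor
    · rintro ⟨b, hb⟩
      obtain ⟨p, hp, hpz⟩ := h.exists_eval_ne_zero z
      have h1 := hb ⟨p, by omega⟩
      rw [meromorphicOrderAt_congr (hev b k ⟨p, by omega⟩)] at h1
      have hmer : MeromorphicAt (fun x => (x - z) ^ ((k : ℤ) - m) • ((A p).eval x / R.eval x)) z :=
        MeromorphicAt.smul (f := fun x => (x - z) ^ ((k : ℤ) - m)) (by fun_prop)
          (han p).meromorphicAt
      rw [(meromorphicOrderAt_eq_int_iff hmer).2 ⟨_, han p, div_ne_zero hpz hRz,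
        Filter.Eventually.of_forall fun x => rfl⟩] at h1
      have h2 : (0 : ℤ) ≤ (k : ℤ) - m := by exact_mod_cast h1
      simp only [Set.mem_Ici]
      omega
    · intro hk
      refine ⟨(Module.finBasis ℂ V).reindex (finCongr h.finrank_eq), fun p => ?_⟩
      rw [meromorphicOrderAt_congr (hev _ k p)]
      have hk' : (k : ℤ) - m = ((k - m : ℕ) : ℤ) := by
        have : m ≤ k := hk
        omega
      simp only [hk', zpow_natCast, smul_eq_mul]
      refine AnalyticAt.meromorphicOrderAt_nonneg ?_
      have := han p
      fun_prop
  rw [poleOrder_eq_of_finrank h.finrank_eq, hset, csInf_Ici]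

lemma IsRegularOp.leadingCoeff_eq (h : IsRegularOp N M A V) (x : ℂ) :
    leadingCoeff V x = (A N).eval x := by
  classical
  have hsing : singularPoints V = ((A N).roots.toFinset : Set ℂ) := by
    ext z
    simp [h.mem_singularPoints_iff, h.monic.ne_zero]
  have hsplit : (A N).roots.card = (A N).natDegree := by
    exact (IsAlgClosed.splits (A N)).natDegree_eq_card_roots.symm
  rw [leadingCoeff, hsing, finprod_mem_coe_finset]
  conv_rhs => rw [← prod_multiset_X_sub_C_of_monic_of_roots_card_eq h.monic hsplit,
    prod_multiset_root_eq_finset_root]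
  rw [eval_prod]
  refine Finset.prod_congr rfl fun z _ => ?_
  rw [h.poleOrder_eq]
  simp

end Coefficients

/-! ### Variation of parameters -/

section Variation

variable {V : Submodule ℂ (ℂ → ℂ)} {n M : ℕ} {A : ℕ → ℂ[X]}

/-- Variation of parameters: `(D̄ g) w_j` has a primitive wherever `D̄` is regular. -/
lemma IsRegularOp.exists_hasDerivAt (h : IsRegularOp (n + 1) M A V)
    (b : Module.Basis (Fin (n + 1)) ℂ V) {g : ℂ → ℂ} (hg : Differentiable ℂ g)
    (j : Fin (n + 1)) :
    ∃ c : ℂ → ℂ, ∀ x, wronskian (basisFun b) x ≠ 0 → (A (n + 1)).eval x ≠ 0 →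
      HasDerivAt c (act (n + 1) A g x * (dualFun b j x * ((A (n + 1)).eval x)⁻¹)) x := by
  have hd : ∀ i, Differentiable ℂ (basisFun b i) := fun i => h.differentiable _ (b i).2
  let F : ℂ → Matrix (Fin (n + 1)) (Fin (n + 1)) ℂ := wrMatrix (n + 1) (basisFun b)
  have hunit : ∀ y, wronskian (basisFun b) y ≠ 0 → IsUnit (F y).det :=
    fun y hy => isUnit_iff_ne_zero.2 hy
  -- The coefficients for which ∑ c_l b_l agrees with g in derivatives of orders 0, …, n. Being
  -- given by a formula, they are single-valued around the singular points.
  let c : Fin (n + 1) → ℂ → ℂ := fun j x =>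
    Matrix.vecMul (fun i : Fin (n + 1) => iteratedDeriv (i : ℕ) g x) (F x)⁻¹ j
  refine ⟨c j, fun x hW hP => ?_⟩
  have hcd : ∀ j, DifferentiableAt ℂ (c j) x := by
    intro j
    simp only [c, Matrix.vecMul, dotProduct]
    refine DifferentiableAt.fun_sum fun i _ => ?_
    exact (differentiable_iteratedDeriv hg i x).mul
      (analyticAt_inv_apply (M := F) (analyticAt_wrMatrix hd x) hW i j).differentiableAt
  have hWev : ∀ᶠ y in 𝓝 x, wronskian (basisFun b) y ≠ 0 :=
    (analyticAt_wronskian hd x).continuousAt.eventually_ne hW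
  have hsolve : ∀ y, wronskian (basisFun b) y ≠ 0 → ∀ i : Fin (n + 1),
      ∑ l, c l y * iteratedDeriv (i : ℕ) (basisFun b l) y = iteratedDeriv (i : ℕ) g y := by
    intro y hy i
    have h1 : Matrix.vecMul (fun l => c l y) (F y) = fun i : Fin (n + 1) =>
        iteratedDeriv (i : ℕ) g y := by
      change Matrix.vecMul (Matrix.vecMul _ (F y)⁻¹) (F y) = _
      rw [Matrix.vecMul_vecMul, Matrix.nonsing_inv_mul _ (hunit y hy),
        Matrix.vecMul_one]
    exact congrFun h1 i
  have hder : ∀ i : Fin (n + 1),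
      ∑ l, (deriv (c l) x * iteratedDeriv (i : ℕ) (basisFun b l) x
        + c l x * iteratedDeriv ((i : ℕ) + 1) (basisFun b l) x)
      = iteratedDeriv ((i : ℕ) + 1) g x := by
    intro i
    have h1 : HasDerivAt (fun y => ∑ l, c l y * iteratedDeriv (i : ℕ) (basisFun b l) y)
        (∑ l, (deriv (c l) x * iteratedDeriv (i : ℕ) (basisFun b l) x
        + c l x * iteratedDeriv ((i : ℕ) + 1) (basisFun b l) x)) x :=
      HasDerivAt.fun_sum fun l _ => (hcd l).hasDerivAt.mul (hasDerivAt_iteratedDeriv (hd l) i x)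
    refine h1.unique ((hasDerivAt_iteratedDeriv hg i x).congr_of_eventuallyEq ?_)
    filter_upwards [hWev] with y hy
    exact hsolve y hy i
  set a : ℂ := act (n + 1) A g x * ((A (n + 1)).eval x)⁻¹ with ha
  have hact : a = iteratedDeriv (n + 1) g x
      - ∑ l, c l x * iteratedDeriv (n + 1) (basisFun b l) x := by
    have h1 : act (n + 1) A g x = (A (n + 1)).eval x * (iteratedDeriv (n + 1) g x
        - ∑ l, c l x * iteratedDeriv (n + 1) (basisFun b l) x)
        + ∑ l, c l x * act (n + 1) A (basisFun b l) x := by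
      simp only [act, Finset.sum_range_succ _ (n + 1), mul_add, Finset.sum_add_distrib,
        Finset.mul_sum, mul_sub]
      rw [Finset.sum_comm (s := Finset.univ)]
      have h2 : ∀ p ∈ Finset.range (n + 1), (A p).eval x * iteratedDeriv p g x
          = ∑ l, c l x * ((A p).eval x * iteratedDeriv p (basisFun b l) x) := by
        intro p hp
        rw [← hsolve x hW ⟨p, Finset.mem_range.1 hp⟩, Finset.mul_sum]
        exact Finset.sum_congr rfl fun l _ => by ring
      rw [Finset.sum_congr rfl h2]
      have h3 : ∀ l, c l x * ((A (n + 1)).eval x * iteratedDeriv (n + 1) (basisFun b l) x)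
          = (A (n + 1)).eval x * (c l x * iteratedDeriv (n + 1) (basisFun b l) x) :=
        fun l => by ring
      simp only [h3]
      ring
    have h4 : ∑ l, c l x * act (n + 1) A (basisFun b l) x = 0 :=
      Finset.sum_eq_zero fun l _ => by
        rw [show act (n + 1) A (basisFun b l) x = 0 from h.act_eq_zero _ (b l).2 x, mul_zero]
    rw [ha, h1, h4, add_zero]
    field_simp
  -- Differentiating the agreement gives ∑ c_l' b_l^{(i)} = 0 for i < n, while for i = n the defect
  -- is Dg / A_{n+1}.
  have hvec : Matrix.vecMul (fun l => deriv (c l) x) (F x) = Pi.single (Fin.last n) a := by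
    funext i
    have h1 := hder i
    rw [Finset.sum_add_distrib] at h1
    refine Fin.lastCases ?_ (fun i => ?_) i (motive := fun i =>
      (∑ l, deriv (c l) x * iteratedDeriv (i : ℕ) (basisFun b l) x)
        + ∑ l, c l x * iteratedDeriv ((i : ℕ) + 1) (basisFun b l) x
        = iteratedDeriv ((i : ℕ) + 1) g x →
      Matrix.vecMul (fun l => deriv (c l) x) (F x) i
        = (Pi.single (Fin.last n) a : Fin (n + 1) → ℂ) i) h1
    · intro h1
      rw [Pi.single_eq_same, hact]
      rw [Fin.val_last] at h1
      rw [← h1, add_sub_cancel_right]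
      rfl
    · intro h1
      rw [Pi.single_eq_of_ne (Fin.castSucc_lt_last i).ne]
      have h2 := hsolve x hW i.succ
      rw [Fin.val_succ] at h2
      rw [Fin.val_castSucc, h2] at h1
      exact add_eq_right.1 h1
  have hsol : (fun l => deriv (c l) x) = Matrix.vecMul (Pi.single (Fin.last n) a) (F x)⁻¹ := by
    rw [← hvec, Matrix.vecMul_vecMul, Matrix.mul_nonsing_inv _ (hunit x hW),
      Matrix.vecMul_one]
  refine (hcd j).hasDerivAt.congr_deriv ?_
  rw [congrFun hsol j, Matrix.single_vecMul]
  simp only [Matrix.row, Pi.smul_apply, smul_eq_mul, ha, dualFun, F]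
  ring

end Variation

/-! ### Integral transforms over small circles -/

lemma eventually_forall_closedBall {z : ℂ} {p : ℂ → Prop} (h : ∀ᶠ x in 𝓝 z, p x) :
    ∀ᶠ r : ℝ in 𝓝[>] 0, ∀ x ∈ Metric.closedBall z r, p x := by
  obtain ⟨ε, hε, hp⟩ := Metric.eventually_nhds_iff_ball.1 h
  filter_upwards [Ioo_mem_nhdsGT hε] with r hr x hx
  exact hp x (Metric.closedBall_subset_ball hr.2 hx)

lemma eventually_forall_sphere {z : ℂ} {p : ℂ → Prop} (h : ∀ᶠ x in 𝓝[≠] z, p x) :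
    ∀ᶠ r : ℝ in 𝓝[>] 0, ∀ x ∈ Metric.sphere z r, p x := by
  filter_upwards [eventually_forall_closedBall (eventually_nhdsWithin_iff.1 h),
    self_mem_nhdsWithin] with r hr hpos x hx
  refine hr x (Metric.sphere_subset_closedBall hx) ?_
  rintro rfl
  simp only [Metric.mem_sphere, dist_self] at hx
  exact (Set.mem_Ioi.1 hpos).ne hx

lemma hasDerivAt_circleIntegral_exp {z : ℂ} {r : ℝ} (hr : 0 ≤ r) {h : ℂ → ℂ}
    (hh : ContinuousOn h (Metric.sphere z r)) (u : ℂ) :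
    HasDerivAt (fun u => ∮ x in C(z, r), Complex.exp (u * x) * h x)
      (∮ x in C(z, r), Complex.exp (u * x) * (x * h x)) u := by
  have hc : Continuous fun θ => h (circleMap z r θ) :=
    hh.comp_continuous (continuous_circleMap z r) fun θ => circleMap_mem_sphere z hr θ
  have hm := continuous_circleMap z r
  have hd : Continuous fun θ => deriv (circleMap z r) θ := by
    simp only [deriv_circleMap]
    exact (continuous_circleMap 0 r).mul continuous_const
  have he : ∀ u : ℂ, Continuous fun θ => Complex.exp (u * circleMap z r θ) :=
    fun u => Complex.continuous_exp.comp (continuous_const.mul hm)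
  have hcont : ∀ u : ℂ, Continuous fun θ => deriv (circleMap z r) θ •
      (Complex.exp (u * circleMap z r θ) * h (circleMap z r θ)) :=
    fun u => hd.smul ((he u).mul hc)
  have hcont' : ∀ u : ℂ, Continuous fun θ => deriv (circleMap z r) θ •
      (Complex.exp (u * circleMap z r θ) * (circleMap z r θ * h (circleMap z r θ))) :=
    fun u => hd.smul ((he u).mul (hm.mul hc))
  let bound : ℝ → ℝ := fun θ => ‖deriv (circleMap z r) θ‖ *
    (Real.exp ((‖u‖ + 1) * ‖circleMap z r θ‖) * ‖circleMap z r θ * h (circleMap z r θ)‖)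
  have hbound : Continuous bound :=
    hd.norm.mul ((Real.continuous_exp.comp (continuous_const.mul hm.norm)).mul (hm.mul hc).norm)
  refine (intervalIntegral.hasDerivAt_integral_of_dominated_loc_of_deriv_le (bound := bound)
    (F' := fun u θ => deriv (circleMap z r) θ •
      (Complex.exp (u * circleMap z r θ) * (circleMap z r θ * h (circleMap z r θ))))
    (Metric.ball_mem_nhds u one_pos) ?_ ((hcont u).intervalIntegrable _ _)
    (hcont' u).aestronglyMeasurable ?_ (hbound.intervalIntegrable _ _) ?_).2
  · exact Filter.Eventually.of_forall fun v => (hcont v).aestronglyMeasurable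
  · refine Filter.Eventually.of_forall fun θ _ v hv => ?_
    rw [norm_smul, norm_mul]
    have hv' : ‖v‖ ≤ ‖u‖ + 1 := by
      have h1 := norm_sub_norm_le v u
      have h2 : ‖v - u‖ < 1 := by simpa [dist_eq_norm] using hv
      linarith
    have hexp : ‖Complex.exp (v * circleMap z r θ)‖
        ≤ Real.exp ((‖u‖ + 1) * ‖circleMap z r θ‖) := by
      refine (Complex.norm_exp_le_exp_norm _).trans (Real.exp_le_exp.2 ?_)
      rw [norm_mul]
      gcongr
    simp only [bound]
    gcongr
  · refine Filter.Eventually.of_forall fun θ _ v _ => ?_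
    have h1 : HasDerivAt (fun v : ℂ => Complex.exp (v * circleMap z r θ))
        (Complex.exp (v * circleMap z r θ) * circleMap z r θ) v := by
      simpa using ((hasDerivAt_id v).mul_const (circleMap z r θ)).cexp
    have h2 := (h1.mul_const (h (circleMap z r θ))).fun_const_smul (deriv (circleMap z r) θ)
    simpa only [mul_assoc] using h2

lemma iteratedDeriv_circleIntegral_exp {z : ℂ} {r : ℝ} (hr : 0 ≤ r) {h : ℂ → ℂ}
    (hh : ContinuousOn h (Metric.sphere z r)) (j : ℕ) (u : ℂ) :
    iteratedDeriv j (fun u => ∮ x in C(z, r), Complex.exp (u * x) * h x) u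
      = ∮ x in C(z, r), Complex.exp (u * x) * (x ^ j * h x) := by
  induction j generalizing h with
  | zero => simp
  | succ j ih =>
    rw [iteratedDeriv_succ', funext fun u => (hasDerivAt_circleIntegral_exp hr hh u).deriv,
      ih (h := fun x => x * h x) (continuousOn_id.fun_mul hh)]
    simp only [pow_succ, mul_assoc]

lemma act_circleIntegral_exp {z : ℂ} {r : ℝ} (hr : 0 ≤ r) {h : ℂ → ℂ}
    (hh : ContinuousOn h (Metric.sphere z r)) (M : ℕ) (B : ℕ → ℂ[X]) (u : ℂ) :
    act M B (fun u => ∮ x in C(z, r), Complex.exp (u * x) * h x) u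
      = ∮ x in C(z, r), (∑ j ∈ Finset.range (M + 1), (B j).eval u * x ^ j) *
          Complex.exp (u * x) * h x := by
  have hint : ∀ j, CircleIntegrable
      (fun x => (B j).eval u * (Complex.exp (u * x) * (x ^ j * h x))) z r := by
    intro j
    refine ContinuousOn.circleIntegrable hr ?_
    exact continuousOn_const.mul ((by fun_prop : ContinuousOn _ _).mul
      ((continuousOn_id.pow j).mul hh))
  simp only [act, iteratedDeriv_circleIntegral_exp hr hh]
  simp_rw [← circleIntegral.integral_const_mul]
  rw [← circleIntegral.integral_fun_sum fun j _ => hint j]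
  congr 1
  funext x
  rw [Finset.sum_mul, Finset.sum_mul]
  exact Finset.sum_congr rfl fun j _ => by ring

lemma isIntegralTransform_unique {f : ℂ → ℂ} {z : ℂ} {g g' : ℂ → ℂ}
    (h : IsIntegralTransform f z g) (h' : IsIntegralTransform f z g') : g = g' := by
  obtain ⟨r, hr, hr'⟩ := (h.and h').exists
  funext u
  rw [hr, hr']

lemma isIntegralTransform_sum {ι : Type*} [Fintype ι] {f : ι → ℂ → ℂ} {z : ℂ} {g : ι → ℂ → ℂ}
    (hf : ∀ i, MeromorphicAt (f i) z) (h : ∀ i, IsIntegralTransform (f i) z (g i)) (c : ι → ℂ) :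
    IsIntegralTransform (∑ i, c i • f i) z (∑ i, c i • g i) := by
  have h1 : ∀ᶠ r : ℝ in 𝓝[>] 0, ∀ i, ∀ x ∈ Metric.sphere z r, AnalyticAt ℂ (f i) x :=
    Filter.eventually_all.2 fun i => eventually_forall_sphere (hf i).eventually_analyticAt
  filter_upwards [h1, Filter.eventually_all.2 h, self_mem_nhdsWithin] with r hr hg hpos u
  have hr0 : 0 ≤ r := (Set.mem_Ioi.1 hpos).le
  have hint : ∀ i, CircleIntegrable (fun x => c i * (Complex.exp (u * x) * f i x)) z r := by
    intro i
    refine ContinuousOn.circleIntegrable hr0 ?_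
    refine continuousOn_const.mul ((by fun_prop : ContinuousOn _ _).mul ?_)
    exact fun x hx => (hr i x hx).continuousAt.continuousWithinAt
  simp only [Finset.sum_apply, Pi.smul_apply, smul_eq_mul, hg]
  simp_rw [← circleIntegral.integral_const_mul]
  rw [← circleIntegral.integral_fun_sum fun i _ => hint i]
  congr 1
  funext x
  rw [Finset.mul_sum]
  exact Finset.sum_congr rfl fun j _ => by ring

/-- On small circles f agrees with a function holomorphic in the disc, so Cauchy's theorem applies.
-/
lemma isIntegralTransform_zero {f : ℂ → ℂ} {z : ℂ} {k : ℤ} (hk : 0 ≤ k)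
    (hf : MeromorphicAt f z) (ho : meromorphicOrderAt f z = (k : WithTop ℤ)) :
    IsIntegralTransform f z 0 := by
  obtain ⟨g, hg, -, hfg⟩ := (meromorphicOrderAt_eq_int_iff hf).1 ho
  lift k to ℕ using hk
  filter_upwards [eventually_forall_sphere hfg, eventually_forall_closedBall
    hg.eventually_analyticAt, self_mem_nhdsWithin] with r hr hr' hpos u
  have hr0 : 0 ≤ r := (Set.mem_Ioi.1 hpos).le
  have h1 : Set.EqOn (fun x => Complex.exp (u * x) * f x)
      (fun x => Complex.exp (u * x) * ((x - z) ^ k * g x)) (Metric.sphere z r) := by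
    intro x hx
    simp only [hr x hx, zpow_natCast, smul_eq_mul]
  rw [circleIntegral.integral_congr hr0 h1, Pi.zero_apply]
  symm
  refine DiffContOnCl.circleIntegral_eq_zero hr0 (DifferentiableOn.diffContOnCl ?_)
  intro x hx
  have := (hr' x (Metric.closure_ball_subset_closedBall hx)).differentiableAt
  refine DifferentiableAt.differentiableWithinAt ?_
  fun_prop

/-- Cauchy's formula gives the d-th derivative of e^{ux} g(x) at z. By Leibniz this is e^{zu} times
a polynomial in u whose top coefficient is a nonzero multiple of g(z). -/
lemma exists_isIntegralTransform_qexp {f : ℂ → ℂ} {z : ℂ} {d : ℕ} (hf : MeromorphicAt f z)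
    (ho : meromorphicOrderAt f z = ((-((d : ℤ) + 1) : ℤ) : WithTop ℤ)) :
    ∃ q : ℂ[X], q.natDegree = d ∧ IsIntegralTransform f z (qexp q z) := by
  obtain ⟨g, hg, hgz, hfg⟩ := (meromorphicOrderAt_eq_int_iff hf).1 ho
  set K : ℂ := 2 * Real.pi * Complex.I / d.factorial with hK
  have hK0 : K ≠ 0 := div_ne_zero Complex.two_pi_I_ne_zero (Nat.cast_ne_zero.2 d.factorial_ne_zero)
  let q : ℂ[X] := ∑ k ∈ Finset.range (d + 1),
    monomial k (K * ((d.choose k : ℂ) * iteratedDeriv (d - k) g z))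
  have hcoeff : q.coeff d ≠ 0 := by
    simp only [q, finsetSum_coeff, coeff_monomial]
    simp [hK0, hgz]
  have hdeg : q.natDegree = d := by
    refine le_antisymm (natDegree_sum_le_of_forall_le _ _ fun k hk => ?_)
      (le_natDegree_of_ne_zero hcoeff)
    exact (natDegree_monomial_le _).trans (by have := Finset.mem_range.1 hk; omega)
  refine ⟨q, hdeg, ?_⟩
  filter_upwards [eventually_forall_sphere hfg, eventually_forall_closedBall
    hg.eventually_analyticAt, self_mem_nhdsWithin] with r hr hr' hpos u
  have hr0 : 0 < r := Set.mem_Ioi.1 hpos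
  have h1 : Set.EqOn (fun x => Complex.exp (u * x) * f x)
      (fun x => (1 / (x - z) ^ (d + 1)) • (Complex.exp (u * x) * g x)) (Metric.sphere z r) := by
    intro x hx
    simp only [hr x hx, smul_eq_mul, zpow_neg]
    rw [show ((d : ℤ) + 1) = ((d + 1 : ℕ) : ℤ) by simp, zpow_natCast]
    ring
  have hexp : ContDiffAt ℂ d (fun x => Complex.exp (u * x)) z := by fun_prop
  rw [circleIntegral.integral_congr hr0.le h1,
    DifferentiableOn.circleIntegral_one_div_sub_center_pow_smul hr0 d
      (fun x hx => by
        have := (hr' x hx).differentiableAt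
        refine DifferentiableAt.differentiableWithinAt ?_
        fun_prop),
    iteratedDeriv_fun_mul hexp hg.contDiffAt]
  simp only [iteratedDeriv_exp_mul, qexp, q, eval_finsetSum, eval_monomial, smul_eq_mul,
    Finset.mul_sum, Finset.sum_mul]
  refine Finset.sum_congr rfl fun k _ => ?_
  rw [mul_comm z u, hK]
  ring

/-! ### The transform of the regularized conjugate space -/

section Transform

variable {V : Submodule ℂ (ℂ → ℂ)} {n M : ℕ} {A : ℕ → ℂ[X]}

/-- The element `w_j / P` of the regularized conjugate space. -/
def regDualFun (P : ℂ[X]) (b : Module.Basis (Fin (n + 1)) ℂ V) (j : Fin (n + 1)) (x : ℂ) : ℂ :=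
  dualFun b j x * (P.eval x)⁻¹

lemma IsRegularOp.regularizedConjugate_eq (h : IsRegularOp (n + 1) M A V)
    (b : Module.Basis (Fin (n + 1)) ℂ V) :
    regularizedConjugate V = Submodule.span ℂ (Set.range (regDualFun (A (n + 1)) b)) := by
  have hlc : ∀ x, leadingCoeff V x = (A (n + 1)).eval x := h.leadingCoeff_eq
  rw [regularizedConjugate, conjugate_eq_span_dualFun h.differentiable b]
  simp only [hlc]
  apply le_antisymm
  · rw [Submodule.span_le]
    rintro _ ⟨f, hf, rfl⟩
    obtain ⟨c, rfl⟩ := (Submodule.mem_span_range_iff_exists_fun ℂ).1 hf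
    refine (Submodule.mem_span_range_iff_exists_fun ℂ).2 ⟨c, ?_⟩
    funext x
    simp only [Finset.sum_apply, Pi.smul_apply, smul_eq_mul, regDualFun, Finset.sum_mul, mul_assoc]
  · rw [Submodule.span_le]
    rintro _ ⟨j, rfl⟩
    exact Submodule.subset_span ⟨_, Submodule.subset_span (Set.mem_range_self j), rfl⟩

lemma IsRegularOp.meromorphicAt_regDualFun (h : IsRegularOp (n + 1) M A V)
    (b : Module.Basis (Fin (n + 1)) ℂ V) (j : Fin (n + 1)) (z : ℂ) :
    MeromorphicAt (regDualFun (A (n + 1)) b j) z :=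
  (meromorphicAt_dualFun h.differentiable b j z).mul
    ((A (n + 1)).differentiable.analyticAt z).meromorphicAt.inv

lemma meromorphicOrderAt_eval {P : ℂ[X]} (hP : P ≠ 0) (z : ℂ) :
    meromorphicOrderAt (fun x => P.eval x) z
      = (((rootMultiplicity z P : ℕ) : ℤ) : WithTop ℤ) := by
  obtain ⟨R, hR, hRz⟩ := exists_eq_pow_rootMultiplicity_mul_and_not_dvd P hP z
  rw [dvd_iff_isRoot, IsRoot.def] at hRz
  rw [meromorphicOrderAt_eq_int_iff (P.differentiable.analyticAt z).meromorphicAt]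
  refine ⟨fun x => R.eval x, R.differentiable.analyticAt z, hRz,
    Filter.Eventually.of_forall fun x => ?_⟩
  conv_lhs => rw [hR]
  simp

/-- The order n - e_j of the dual function, less the multiplicity n + 1 - s of the root of the
leading coefficient. -/
lemma IsRegularOp.meromorphicOrderAt_regDualFun (h : IsRegularOp (n + 1) M A V)
    {b : Module.Basis (Fin (n + 1)) ℂ V} {z : ℂ} {e : Fin (n + 1) → ℕ} (hb : IsAdapted b z e)
    {s : ℕ} (hs : s ≤ n + 1) (hmult : rootMultiplicity z (A (n + 1)) = n + 1 - s)
    (j : Fin (n + 1)) :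
    meromorphicOrderAt (regDualFun (A (n + 1)) b j) z
      = (((s : ℤ) - 1 - e j : ℤ) : WithTop ℤ) := by
  have hP := ((A (n + 1)).differentiable.analyticAt z).meromorphicAt
  have h1 := meromorphicOrderAt_mul (meromorphicAt_dualFun h.differentiable b j z) hP.inv
  rw [meromorphicOrderAt_inv, meromorphicOrderAt_dualFun h.differentiable hb,
    meromorphicOrderAt_eval h.monic.ne_zero, hmult] at h1
  refine h1.trans ?_
  rw [← WithTop.LinearOrderedAddCommGroup.coe_neg, ← WithTop.coe_add]
  congr 1
  omega

/-- Under the integral the exchanged operator acts on e^{ux} as the original one does in x;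
variation of parameters then makes the integrand an exact derivative on the circle. -/
lemma IsRegularOp.act_transform_eq_zero (h : IsRegularOp (n + 1) M A V)
    (b : Module.Basis (Fin (n + 1)) ℂ V) (j : Fin (n + 1)) {z : ℂ} {g : ℂ → ℂ}
    (hg : IsIntegralTransform (regDualFun (A (n + 1)) b j) z g) (u : ℂ) :
    act M (swapOp (n + 1) A) g u = 0 := by
  have := h.finiteDimensional
  have hP : ∀ᶠ x in 𝓝[≠] z, (A (n + 1)).eval x ≠ 0 := by
    have h1 := (meromorphicOrderAt_ne_top_iff_eventually_ne_zero
      ((A (n + 1)).differentiable.analyticAt z).meromorphicAt).1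
      (by rw [meromorphicOrderAt_eval h.monic.ne_zero]; exact WithTop.coe_ne_top)
    exact h1
  obtain ⟨r, hr, hW, hPr, han, hpos⟩ := (hg.and ((eventually_forall_sphere
    (eventually_wronskian_ne_zero h.differentiable b z)).and ((eventually_forall_sphere hP).and
    ((eventually_forall_sphere (h.meromorphicAt_regDualFun b j z).eventually_analyticAt).and
    self_mem_nhdsWithin)))).exists
  have hr0 : 0 ≤ r := (Set.mem_Ioi.1 hpos).le
  have hcont : ContinuousOn (regDualFun (A (n + 1)) b j) (Metric.sphere z r) :=
    fun x hx => (han x hx).continuousAt.continuousWithinAt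
  obtain ⟨c, hc⟩ := h.exists_hasDerivAt b
    (show Differentiable ℂ fun x => Complex.exp (u * x) by fun_prop) j
  rw [funext hr, act_circleIntegral_exp hr0 hcont]
  refine circleIntegral.integral_eq_zero_of_hasDerivWithinAt (f := c) hr0 fun x hx => ?_
  refine ((hc x (hW x hx) (hPr x hx)).congr_deriv ?_).hasDerivWithinAt
  rw [act_exp, sum_eval_mul_pow_eq h.natDegree_le]
  rfl

end Transform

lemma card_lt_exponent {N s : ℕ} {e : Fin N → ℕ} (hinj : Function.Injective e)
    (hmem : ∀ k < s, k ∈ Set.range e) (hs : s ∉ Set.range e) :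
    Fintype.card {j // s < e j} = N - s := by
  have h1 : (Finset.univ.filter fun j => ¬ s < e j).image e = Finset.range s := by
    ext k
    simp only [Finset.mem_image, Finset.mem_filter, Finset.mem_univ, true_and, Finset.mem_range]
    constructor
    · rintro ⟨j, hj, rfl⟩
      exact lt_of_le_of_ne (not_lt.1 hj) fun h => hs ⟨j, h⟩
    · intro hk
      obtain ⟨j, rfl⟩ := hmem k hk
      exact ⟨j, not_lt.2 hk.le, rfl⟩
  have h2 : (Finset.univ.filter fun j => ¬ s < e j).card = s := by
    rw [← Finset.card_image_of_injective _ hinj, h1, Finset.card_range]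
  have h3 := Finset.card_filter_add_card_filter_not (s := (Finset.univ : Finset (Fin N)))
    (fun j => s < e j)
  rw [Finset.card_univ, Fintype.card_fin, h2] at h3
  rw [Fintype.card_subtype]
  omega

/-- The transform of a space with a regular operator `A` is a space of quasi-polynomials, of
dimension `M`, annihilated by `A` with `x` and `∂` exchanged. -/
theorem IsRegularOp.transformSpace_spec {N M : ℕ} {A : ℕ → ℂ[X]} {V : Submodule ℂ (ℂ → ℂ)}
    (h : IsRegularOp N M A V) :
    IsQuasiPolynomialSpace (transformSpace V) ∧ Module.finrank ℂ (transformSpace V) = M ∧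
      ∀ f ∈ transformSpace V, ∀ u, act M (swapOp N A) f u = 0 := by
  classical
  have hfd := h.finiteDimensional
  have hsing : ∀ z, z ∈ singularPoints V ↔ z ∈ (A N).roots.toFinset := by
    intro z
    simp [h.mem_singularPoints_iff, h.monic.ne_zero]
  have hroots : ∑ z ∈ (A N).roots.toFinset, rootMultiplicity z (A N) = M := by
    rw [← h.natDegree_eq, (IsAlgClosed.splits (A N)).natDegree_eq_card_roots,
      ← Multiset.toFinset_sum_count_eq]
    exact Finset.sum_congr rfl fun z _ => (count_roots _).symm
  suffices hfam : ∃ (ι : Type) (_ : Fintype ι) (q : ι → ℂ[X]) (m : ι → ℂ),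
      (∀ a, 0 < (q a).natDegree) ∧ (Function.Injective fun a => (m a, (q a).natDegree)) ∧
      Fintype.card ι = M ∧
      (∀ a u, act M (swapOp N A) (qexp (q a) (m a)) u = 0) ∧
      transformSpace V = Submodule.span ℂ (Set.range fun a => qexp (q a) (m a)) by
    obtain ⟨ι, _, q, m, hq, hinj, hcard, hact, hT⟩ := hfam
    rw [hT]
    refine ⟨isQuasiPolynomialSpace_of_family q m hq hinj,
      (finrank_span_qexp q m hq hinj).trans hcard, fun f hf u => ?_⟩
    have hlin : Differentiable ℂ f ∧ ∀ u, act M (swapOp N A) f u = 0 := by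
      induction hf using Submodule.span_induction with
      | mem f hf =>
        obtain ⟨a, rfl⟩ := hf
        exact ⟨differentiable_qexp _ _, hact a⟩
      | zero => exact ⟨differentiable_const 0, fun x => by simp [act]⟩
      | add f g _ _ hf hg =>
        exact ⟨hf.1.add hg.1, fun x => by rw [act_add _ _ hf.1 hg.1, hf.2, hg.2, add_zero]⟩
      | smul a f _ hf =>
        exact ⟨hf.1.const_smul a, fun x => by rw [act_smul, hf.2, mul_zero]⟩
    exact hlin.2 u
  -- For N = 0 there is no dual basis, but absence of common zeros means that A_0 has no roots, so
  -- there are no singular points and both sides are trivial.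
  obtain _ | n := N
  · have hnr : ∀ z, z ∉ (A 0).roots.toFinset := by
      intro z hz
      obtain ⟨p, hp, hpz⟩ := h.exists_eval_ne_zero z
      obtain rfl : p = 0 := by omega
      exact hpz (by simpa [h.monic.ne_zero] using hz)
    refine ⟨Empty, inferInstance, Empty.elim, Empty.elim, fun a => a.elim, fun a => a.elim, ?_,
      fun a => a.elim, ?_⟩
    · rw [← hroots, Finset.eq_empty_of_forall_notMem hnr]
      rfl
    · rw [Set.range_eq_empty, Submodule.span_empty, transformSpace, Submodule.span_eq_bot]
      rintro g ⟨z, hz, -⟩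
      exact absurd ((hsing z).1 hz) (hnr z)
  choose b e hb using fun z => exists_isAdapted h.differentiable z h.finrank_eq
  choose s hsN hmult hmem hs using fun z => h.exists_exponent_gap (hb z)
  set P := A (n + 1) with hP
  have hord : ∀ z j, meromorphicOrderAt (regDualFun P (b z) j) z
      = (((s z : ℤ) - 1 - e z j : ℤ) : WithTop ℤ) := fun z j =>
    h.meromorphicOrderAt_regDualFun (hb z) (hsN z) (hmult z) j
  have hmer : ∀ z j, MeromorphicAt (regDualFun P (b z) j) z := fun z j =>
    h.meromorphicAt_regDualFun (b z) j z
  have hq : ∀ z j, ∃ q : ℂ[X], IsIntegralTransform (regDualFun P (b z) j) z (qexp q z) ∧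
      (s z < e z j → q.natDegree = e z j - s z) ∧ (¬ s z < e z j → q = 0) := by
    intro z j
    by_cases hlt : s z < e z j
    · obtain ⟨q, hq1, hq2⟩ := exists_isIntegralTransform_qexp (d := e z j - s z) (hmer z j)
        (by rw [hord]; congr 1; omega)
      exact ⟨q, hq2, fun _ => hq1, fun h => absurd hlt h⟩
    · refine ⟨0, ?_, fun h => absurd h hlt, fun _ => rfl⟩
      -- The gap at s excludes a simple pole, which would give a polynomial of degree 0.
      have hne : e z j ≠ s z := fun h => hs z ⟨j, h⟩
      have h0 : qexp 0 z = 0 := by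
        funext u
        simp [qexp]
      rw [h0]
      exact isIntegralTransform_zero (by omega) (hmer z j) (hord z j)
  choose q hq1 hq2 hq3 using hq
  refine ⟨(z : P.roots.toFinset) × {j // s z < e z j}, inferInstance, fun a => q a.1 a.2,
    fun a => a.1, ?_, ?_, ?_, ?_, ?_⟩
  · rintro ⟨z, j, hj⟩
    rw [hq2 z j hj]
    omega
  · rintro ⟨z, j, hj⟩ ⟨z', j', hj'⟩ hzj
    simp only [Prod.mk.injEq] at hzj
    obtain rfl := Subtype.ext hzj.1
    obtain rfl : j = j' := by
      apply (hb z).injective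
      have := hzj.2
      rw [hq2 _ j hj, hq2 _ j' hj'] at this
      omega
    rfl
  · rw [Fintype.card_sigma, ← hroots,
      ← Finset.sum_coe_sort P.roots.toFinset fun z => rootMultiplicity z P]
    refine Finset.sum_congr rfl fun z _ => ?_
    rw [card_lt_exponent (hb z).injective (hmem z) (hs z), hmult]
  · rintro ⟨z, j, hj⟩ u
    exact h.act_transform_eq_zero (b z) j (hq1 z j) u
  · apply le_antisymm
    · rw [transformSpace, Submodule.span_le]
      rintro g ⟨z, hz, f, hf, hfg⟩
      rw [h.regularizedConjugate_eq (b z)] at hf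
      obtain ⟨c, rfl⟩ := (Submodule.mem_span_range_iff_exists_fun ℂ).1 hf
      rw [isIntegralTransform_unique hfg (isIntegralTransform_sum (hmer z) (hq1 z) c)]
      refine Submodule.sum_mem _ fun j _ => Submodule.smul_mem _ _ ?_
      by_cases hlt : s z < e z j
      · exact Submodule.subset_span ⟨⟨⟨z, (hsing z).1 hz⟩, j, hlt⟩, rfl⟩
      · have h0 : qexp (q z j) z = 0 := by
          funext u
          simp [qexp, hq3 z j hlt]
        rw [h0]
        exact Submodule.zero_mem _
    · rw [Submodule.span_le]
      rintro _ ⟨⟨z, j, hj⟩, rfl⟩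
      refine Submodule.subset_span ⟨z, (hsing z).2 z.2, regDualFun P (b z) j, ?_, hq1 z j⟩
      rw [h.regularizedConjugate_eq (b z)]
      exact Submodule.subset_span (Set.mem_range_self j)

end Bispectral

end

theorem corollary2p6 (V U : Submodule ℂ (ℂ → ℂ)) (h : Bispectral.IsBispectralDual U V) :
    Bispectral.IsBispectralDual V U := by
  obtain ⟨hV, rfl⟩ := h
  obtain ⟨N, M, A, hA⟩ := Bispectral.exists_isRegularOp hV
  obtain ⟨hU, hr, h0⟩ := hA.transformSpace_spec
  -- The exchanged operator is regular for U, so the transform of U is killed by the twice exchanged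
  -- operator, which is A, and it has dimension N.
  obtain ⟨hT, hr', h0'⟩ := (hA.swap hV hU hr h0).transformSpace_spec
  refine ⟨hU, (Bispectral.eq_of_act_eq_zero hA hT.differentiable (fun f hf x => ?_) hr').symm⟩
  rw [← h0' f hf x]
  exact Bispectral.act_congr
    (fun p hp => (Bispectral.swapOp_swapOp hA.natDegree_le hp).symm) f x
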